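/- Let $p$ be an odd prime. For elements $x,y$ of a group write $[x,y]=x^{-1}y^{-1}xy$, and for groups $A_1,\dots,A_n$ of class at most two let $A_1\amalg^{\mathfrak N_2}\cdots\amalg^{\mathfrak N_2}A_n=F/F_3$ denote their $2$-nilpotent product, where $F=A_1*\cdots*A_n$ is the free product and $F_3=[[F,F],F]$. If $H\le Z(A)$ and $\phi\colon H\to Z(B)$ is an embedding, let $A\times_\phi B=(A\times B)/\{(h,\phi(h)^{-1})\mid h\in H\}$ be the amalgamated direct product. A group $G$ is capable if $G\cong K/Z(K)$ for some group $K$. Let $E$ be the extra-special $p$-group of order $p^5$ and exponent $p$ (which exists and is unique up to isomorphism), and let $C_p$ be the cyclic group of order $p$. Let $G$ be a group of nilpotency class at most two and exponent $p$ that can be generated by $5$ elements but not by fewer. Then $G$ is one and only one of the following: (i) isomorphic to the direct product $E\times C_p$; (ii) isomorphic to the amalgamated direct product \[\bigl(\langle x_1\rangle\amalg^{\mathfrak N_2}\langle x_2\rangle\bigr)\times_\phi\bigl(\langle x_3\rangle\amalg^{\mathfrak N_2}\langle x_4\rangle\amalg^{\mathfrak N_2}\langle x_5\rangle\bigr),\]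 with each $x_i$ of order $p$, where $\phi$ is the embedding of $\langle[x_2,x_1]\rangle$ with $\phi([x_2,x_1])=[x_4,x_3]$; (iii) isomorphic to the amalgamated direct product \[\bigl(\langle x_1\rangle\amalg^{\mathfrak N_2}\langle x_2\rangle\bigr)\times_\phi\Bigl(\bigl(\langle x_3\rangle\amalg^{\mathfrak N_2}\langle x_4\rangle\amalg^{\mathfrak N_2}\langle x_5\rangle\bigr)/\langle[x_5,x_4]\rangle\Bigr),\] with each $x_i$ of order $p$, where $\phi$ is the embedding of $\langle[x_2,x_1]\rangle$ with $\phi([x_2,x_1])=[x_4,x_3]$ (the image of $[x_4,x_3]$ in the quotient); (iv) capable. -/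

import Mathlib

universe u v w

open scoped commutatorElement

theorem Subgroup.normal_of_subset_center {G : Type*} [Group G] {N : Subgroup G}
    (h : N ≤ Subgroup.center G) : N.Normal :=
  ⟨fun n hn g => by rwa [Subgroup.mem_center_iff.1 (h hn) g, mul_inv_cancel_right]⟩

/-- `G` is capable if it is isomorphic to the central quotient of some group. The universe of the
witnessing group is a free parameter. -/
def IsCapable (G : Type u) [Group G] : Prop :=
  ∃ (H : Type v) (_ : Group H), Nonempty (G ≃* H ⧸ Subgroup.center H)

/-- `G` is nilpotent of class at most `k`: the term `G_{k+1}` of the lower central series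
(`G_1 = G`, `G_{n+1} = [G_n, G]`) is trivial. Mathlib numbers the series from `0`. -/
def IsClassLE (k : ℕ) (G : Type u) [Group G] : Prop :=
  (⊤ : Subgroup G).lowerCentralSeries k = ⊥

/-- Extra-special `p`-groups: the center coincides with the commutator subgroup and has order `p`,
and the central quotient is elementary abelian. -/
structure IsExtraSpecial (p : ℕ) (E : Type u) [Group E] : Prop where
  isPGroup : IsPGroup p E
  card_center : Nat.card (Subgroup.center E) = p
  commutator_eq_center : commutator E = Subgroup.center E
  pow_mem_center : ∀ x : E, x ^ p ∈ Subgroup.center E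

/-- The `k`-nilpotent product `F / F_{k+1}` of the family `A`, where `F` is the free product. -/
abbrev NilpotentProduct (k : ℕ) {ι : Type u} (A : ι → Type v) [∀ i, Group (A i)] :=
  Monoid.CoprodI A ⧸ (⊤ : Subgroup (Monoid.CoprodI A)).lowerCentralSeries k

/-- The `2`-nilpotent product of `n` cyclic groups of order `p`. -/
abbrev NilCyclic (p n : ℕ) :=
  NilpotentProduct 2 (fun _ : Fin n => Multiplicative (ZMod p))

/-- The generator of the `i`-th cyclic factor. -/
def NilCyclic.gen (p n : ℕ) (i : Fin n) : NilCyclic p n :=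
  QuotientGroup.mk (Monoid.CoprodI.of (M := fun _ : Fin n => Multiplicative (ZMod p)) (i := i)
    (Multiplicative.ofAdd 1))

theorem NilCyclic.commutator_mem_center {p n : ℕ} (x y : NilCyclic p n) :
    ⁅x, y⁆ ∈ Subgroup.center (NilCyclic p n) := by
  obtain ⟨a, rfl⟩ := QuotientGroup.mk_surjective x
  obtain ⟨b, rfl⟩ := QuotientGroup.mk_surjective y
  rw [Subgroup.mem_center_iff]
  intro z
  obtain ⟨c, rfl⟩ := QuotientGroup.mk_surjective z
  symm
  rw [← commutatorElement_eq_one_iff_mul_comm]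
  refine (QuotientGroup.eq_one_iff ⁅⁅a, b⁆, c⁆).2 ?_
  exact Subgroup.commutator_mem_commutator
    (Subgroup.commutator_mem_commutator (Subgroup.mem_top a) (Subgroup.mem_top b))
    (Subgroup.mem_top c)

instance NilCyclic.zpowers_commutator_normal {p n : ℕ} (x y : NilCyclic p n) :
    (Subgroup.zpowers ⁅x, y⁆).Normal :=
  Subgroup.normal_of_subset_center
    (by simpa [Subgroup.zpowers_le] using NilCyclic.commutator_mem_center x y)

/-- The `2`-nilpotent product of three cyclic groups of order `p` with generators `y₀, y₁, y₂`,
modulo the (central) subgroup generated by `[y₂, y₁]`. -/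
abbrev NilCyclicThreeMod (p : ℕ) :=
  NilCyclic p 3 ⧸ Subgroup.zpowers ⁅NilCyclic.gen p 3 2, NilCyclic.gen p 3 1⁆

section Amalgam

variable {A : Type u} {B : Type v} [Group A] [Group B]

/-- For a subgroup `H` of `Z(A)` and `φ : H → Z(B)`, the subgroup `{(h, φ(h)⁻¹) | h ∈ H}` of
`A × B`. -/
def amalgamSubgroup (H : Subgroup (Subgroup.center A)) (φ : H →* Subgroup.center B) :
    Subgroup (A × B) where
  carrier := {z | ∃ h : H, z = (((h : Subgroup.center A) : A), (φ h : B)⁻¹)}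
  one_mem' := ⟨1, Prod.ext (by simp) (by simp)⟩
  mul_mem' := by
    rintro _ _ ⟨h, rfl⟩ ⟨k, rfl⟩
    refine ⟨h * k, Prod.ext (by simp) ?_⟩
    simpa using Subgroup.mem_center_iff.1 (inv_mem (φ k).2) _
  inv_mem' := by
    rintro _ ⟨h, rfl⟩
    exact ⟨h⁻¹, by simp⟩

instance amalgamSubgroup_normal (H : Subgroup (Subgroup.center A))
    (φ : H →* Subgroup.center B) : (amalgamSubgroup H φ).Normal := by
  apply Subgroup.normal_of_subset_center
  intro z hz
  obtain ⟨h, rfl⟩ := hz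
  rw [Subgroup.mem_center_iff]
  rintro ⟨a, b⟩
  exact Prod.ext (Subgroup.mem_center_iff.1 h.1.2 a)
    (Subgroup.mem_center_iff.1 (inv_mem (φ h).2) b)

/-- The amalgamated direct product `A ×_φ B = (A × B) / {(h, φ(h)⁻¹) | h ∈ H}`; it is used only
for injective `φ`. -/
abbrev AmalgamatedProduct (H : Subgroup (Subgroup.center A)) (φ : H →* Subgroup.center B) :=
  (A × B) ⧸ amalgamSubgroup H φ

/-- `G` is isomorphic to the amalgamated direct product `A ×_φ B`, where the embedding `φ` of the
cyclic subgroup `⟨a⟩ ≤ Z(A)` into `Z(B)` satisfies `φ(a) = b`. -/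
def IsAmalgam (G : Type*) [Group G] (a : A) (b : B) : Prop :=
  ∃ (H : Subgroup (Subgroup.center A)) (φ : H →* Subgroup.center B),
    H.map (Subgroup.center A).subtype = Subgroup.zpowers a ∧
    Function.Injective φ ∧
    (∃ h : H, ((h : Subgroup.center A) : A) = a ∧ (φ h : B) = b) ∧
    Nonempty (G ≃* AmalgamatedProduct H φ)

end Amalgam

/-- `G` is a direct product `E × C_p`. -/
def IsTypeI (p : ℕ) (E : Type v) [Group E] (G : Type u) [Group G] : Prop :=
  Nonempty (G ≃* E × Multiplicative (ZMod p))

/-- `G ≅ (⟨x₁⟩ ∐ ⟨x₂⟩) ×_φ (⟨x₃⟩ ∐ ⟨x₄⟩ ∐ ⟨x₅⟩)` with `2`-nilpotent products, each `xᵢ` of order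
`p`, and `φ([x₂, x₁]) = [x₄, x₃]`. Here `x₁, x₂` are the generators `0, 1` of the first factor and
`x₃, x₄, x₅` the generators `0, 1, 2` of the second one. The factors have class two, so that
`x y x⁻¹ y⁻¹ = x⁻¹ y⁻¹ x y` in them. -/
def IsTypeII (p : ℕ) (G : Type u) [Group G] : Prop :=
  IsAmalgam G
    ⁅NilCyclic.gen p 2 1, NilCyclic.gen p 2 0⁆
    ⁅NilCyclic.gen p 3 1, NilCyclic.gen p 3 0⁆

/-- `G ≅ (⟨x₁⟩ ∐ ⟨x₂⟩) ×_φ ((⟨x₃⟩ ∐ ⟨x₄⟩ ∐ ⟨x₅⟩) / ⟨[x₅, x₄]⟩)`, each `xᵢ` of order `p`, and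
`φ([x₂, x₁]) = [x₄, x₃]`. -/
def IsTypeIII (p : ℕ) (G : Type u) [Group G] : Prop :=
  IsAmalgam G
    ⁅NilCyclic.gen p 2 1, NilCyclic.gen p 2 0⁆
    (QuotientGroup.mk ⁅NilCyclic.gen p 3 1, NilCyclic.gen p 3 0⁆ :
      NilCyclicThreeMod p)

/-!
For odd `p`, Baer's correspondence turns a group `G` of class at most two and exponent `p` into an
alternating bilinear map `c : V × V → U` over `𝔽_p`, the commutator map. In a central extension of
`G`, the commutators of lifts of elements of `U` and of `V` satisfy the Jacobi identity relative to
`c`; conversely, every bilinear form `β : U × V → 𝔽_p` that satisfies it arises in this way. So `G`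
is capable as soon as no `u ≠ 0` in `U` is annihilated by every such `β`.

Suppose that `dim V = 5` and that some `u ≠ 0` is annihilated by every `β`. Then for a functional
`l` with `l u = 1` the form `l ∘ c` has rank four, and the forms `m ∘ c` with `m u = 0` are
determined by their contractions with the radical of `l ∘ c`. Any two independent contractions
pair nontrivially under `l ∘ c`, so they span a space of dimension `0`, `1` or `2`; this gives the
types (i), (iii) and (ii), whose orders `p⁶`, `p⁷` and `p⁸` are distinct. Each of these is a central
product of two groups that amalgamates a commutator of one with a commutator of the other. By the
three subgroups lemma such a commutator is trivial if the product is capable.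
-/

open Module

/-- The Baer group of a bilinear map `c : V × V → U`: the set `V × U` with the multiplication
`(v, a) (w, b) = (v + w, a + b + c(v, w) / 2)`. -/
@[ext]
structure BaerGroup {F V U : Type*} [Field F] [AddCommGroup V] [Module F V] [AddCommGroup U]
    [Module F U] (c : V →ₗ[F] V →ₗ[F] U) where
  fst : V
  snd : U

namespace BaerGroup

section Basic

variable {F V U V' U' : Type*} [Field F] [AddCommGroup V] [Module F V] [AddCommGroup U]
  [Module F U] [AddCommGroup V'] [Module F V'] [AddCommGroup U'] [Module F U']
  {c : V →ₗ[F] V →ₗ[F] U} {c' : V' →ₗ[F] V' →ₗ[F] U'}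

instance : One (BaerGroup c) := ⟨⟨0, 0⟩⟩

instance : Mul (BaerGroup c) :=
  ⟨fun x y => ⟨x.fst + y.fst, x.snd + y.snd + (2⁻¹ : F) • c x.fst y.fst⟩⟩

instance : Inv (BaerGroup c) := ⟨fun x => ⟨-x.fst, -x.snd + (2⁻¹ : F) • c x.fst x.fst⟩⟩

@[simp] theorem one_fst : (1 : BaerGroup c).fst = 0 := rfl
@[simp] theorem one_snd : (1 : BaerGroup c).snd = 0 := rfl
@[simp] theorem mul_fst (x y : BaerGroup c) : (x * y).fst = x.fst + y.fst := rfl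
@[simp] theorem mul_snd (x y : BaerGroup c) :
    (x * y).snd = x.snd + y.snd + (2⁻¹ : F) • c x.fst y.fst := rfl
@[simp] theorem inv_fst (x : BaerGroup c) : (x⁻¹).fst = -x.fst := rfl
@[simp] theorem inv_snd (x : BaerGroup c) :
    (x⁻¹).snd = -x.snd + (2⁻¹ : F) • c x.fst x.fst := rfl

instance : Group (BaerGroup c) :=
  Group.ofLeftAxioms
    (fun x y z => by
      ext
      · simp [add_assoc]
      · simp only [mul_snd, mul_fst, map_add, LinearMap.add_apply, smul_add]
        abel)
    (fun x => by ext <;> simp)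
    (fun x => by ext <;> simp)

/-- The homomorphism of Baer groups induced by a pair of linear maps compatible with the bilinear
maps. -/
@[simps]
def map (f : V →ₗ[F] V') (g : U →ₗ[F] U') (h : ∀ x y, g (c x y) = c' (f x) (f y)) :
    BaerGroup c →* BaerGroup c' where
  toFun x := ⟨f x.fst, g x.snd⟩
  map_one' := by ext <;> simp
  map_mul' x y := by ext <;> simp [h]

/-- The isomorphism of Baer groups induced by a pair of linear equivalences compatible with the
bilinear maps. -/
def congr (f : V ≃ₗ[F] V') (g : U ≃ₗ[F] U') (h : ∀ x y, g (c x y) = c' (f x) (f y)) :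
    BaerGroup c ≃* BaerGroup c' where
  __ := map (f : V →ₗ[F] V') (g : U →ₗ[F] U') h
  invFun x := ⟨f.symm x.fst, g.symm x.snd⟩
  left_inv x := by ext <;> simp
  right_inv x := by ext <;> simp

/-- The bijection of a Baer group with the product of its two spaces. -/
def equivProd (c : V →ₗ[F] V →ₗ[F] U) : BaerGroup c ≃ V × U where
  toFun x := (x.fst, x.snd)
  invFun x := ⟨x.1, x.2⟩

theorem natCard_eq (c : V →ₗ[F] V →ₗ[F] U) :
    Nat.card (BaerGroup c) = Nat.card V * Nat.card U := by
  rw [Nat.card_congr (equivProd c), Nat.card_prod]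

/-- The subgroup of the elements of a Baer group whose first component lies in a given subspace. -/
def comapFst (c : V →ₗ[F] V →ₗ[F] U) (W : Submodule F V) : Subgroup (BaerGroup c) where
  carrier := {x | x.fst ∈ W}
  one_mem' := W.zero_mem
  mul_mem' := W.add_mem
  inv_mem' := W.neg_mem

@[simp] theorem mem_comapFst {W : Submodule F V} {x : BaerGroup c} :
    x ∈ comapFst c W ↔ x.fst ∈ W := Iff.rfl

theorem pow_eq (hc : c.IsAlt) (x : BaerGroup c) (n : ℕ) : x ^ n = ⟨n • x.fst, n • x.snd⟩ := by
  induction n with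
  | zero => ext <;> simp
  | succ n ih => rw [pow_succ, ih]; ext <;> simp [hc.self_eq_zero, succ_nsmul]

theorem mk_zero_mem (hs : Submodule.map₂ c ⊤ ⊤ = ⊤) {H : Subgroup (BaerGroup c)}
    (hH : ∀ v w, ⟨0, c v w⟩ ∈ H) (u : U) : ⟨0, u⟩ ∈ H := by
  have hu : u ∈ Submodule.span F (Set.image2 (fun v w => c v w) Set.univ Set.univ) := by
    rw [← Submodule.top_coe (R := F), ← Submodule.map₂_eq_span_image2, hs]
    exact Submodule.mem_top
  induction hu using Submodule.closure_induction with
  | zero => exact H.one_mem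
  | add a b _ _ ha hb =>
    have mk_add : (⟨0, a + b⟩ : BaerGroup c) = ⟨0, a⟩ * ⟨0, b⟩ := by ext <;> simp
    exact mk_add ▸ H.mul_mem ha hb
  | smul_mem r a ha =>
    obtain ⟨v, -, w, -, rfl⟩ := ha
    simpa using hH (r • v) w

section Commutator

variable [NeZero (2 : F)]

theorem commutator_eq (hc : c.IsAlt) (x y : BaerGroup c) : ⁅x, y⁆ = ⟨0, c x.fst y.fst⟩ := by
  rw [commutatorElement_def, mul_inv_eq_iff_eq_mul, mul_inv_eq_iff_eq_mul]
  ext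
  · simp [add_comm]
  · have two_halves : (2⁻¹ : F) • c x.fst y.fst + (2⁻¹ : F) • c x.fst y.fst = c x.fst y.fst := by
      rw [← two_smul F, smul_inv_smul₀ two_ne_zero]
    simp only [mul_snd, mul_fst, map_zero, LinearMap.zero_apply, smul_zero, add_zero, zero_add,
      ← hc.neg x.fst y.fst, smul_neg]
    nth_rewrite 2 [← two_halves]
    abel

theorem mem_center_iff (hc : c.IsAlt) {x : BaerGroup c} :
    x ∈ Subgroup.center (BaerGroup c) ↔ c x.fst = 0 := by
  simp only [Subgroup.mem_center_iff, ← commutatorElement_eq_one_iff_mul_comm, commutator_eq hc,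
    BaerGroup.ext_iff, one_fst, one_snd, true_and]
  exact ⟨fun h => LinearMap.ext fun v => hc.eq_iff.1 (h ⟨v, 0⟩),
    fun h y => hc.eq_iff.1 (by rw [h, LinearMap.zero_apply])⟩

theorem mk_zero_mem_center (hc : c.IsAlt) (u : U) :
    (⟨0, u⟩ : BaerGroup c) ∈ Subgroup.center (BaerGroup c) :=
  (mem_center_iff hc).2 (map_zero c)

theorem mem_commutator_iff (hc : c.IsAlt) (hs : Submodule.map₂ c ⊤ ⊤ = ⊤) {x : BaerGroup c} :
    x ∈ commutator (BaerGroup c) ↔ x.fst = 0 := by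
  constructor
  · have : commutator (BaerGroup c) ≤ comapFst c ⊥ := by
      refine Subgroup.commutator_le.2 fun x _ y _ => ?_
      rw [commutator_eq hc, mem_comapFst, Submodule.mem_bot]
    exact fun hx => (Submodule.mem_bot F).1 (this hx)
  · obtain ⟨v, u⟩ := x
    rintro rfl
    refine mk_zero_mem hs (fun v w => ?_) u
    rw [← commutator_eq hc ⟨v, 0⟩ ⟨w, 0⟩]
    exact Subgroup.commutator_mem_commutator (Subgroup.mem_top _) (Subgroup.mem_top _)

end Commutator

end Basic

section ZMod

variable {p : ℕ} [Fact p.Prime] {V U : Type*} [AddCommGroup V] [Module (ZMod p) V]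
  [AddCommGroup U] [Module (ZMod p) U] {c : V →ₗ[ZMod p] V →ₗ[ZMod p] U}

theorem pow_prime_eq_one (hc : c.IsAlt) (x : BaerGroup c) : x ^ p = 1 := by
  rw [pow_eq hc]
  ext <;> simp [← Nat.cast_smul_eq_nsmul (ZMod p)]

theorem exponent_eq (hc : c.IsAlt) [Nontrivial V] : Monoid.exponent (BaerGroup c) = p := by
  refine ((Nat.dvd_prime Fact.out).1 <|
    Monoid.exponent_dvd_of_forall_pow_eq_one (pow_prime_eq_one hc)).resolve_left fun h => ?_
  have := Monoid.exp_eq_one_iff.1 h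
  obtain ⟨v, hv⟩ := exists_ne (0 : V)
  exact hv (congrArg fst (Subsingleton.elim (⟨v, 0⟩ : BaerGroup c) 1))

theorem span_image_fst_eq_top {S : Set (BaerGroup c)} (hS : Subgroup.closure S = ⊤) :
    Submodule.span (ZMod p) (fst '' S) = ⊤ := by
  have : comapFst c (Submodule.span (ZMod p) (fst '' S)) = ⊤ :=
    eq_top_iff.2 <| hS ▸ (Subgroup.closure_le _).2 fun x hx =>
      Submodule.subset_span (Set.mem_image_of_mem fst hx)
  exact eq_top_iff.2 fun v _ => mem_comapFst.1
    (this ▸ Subgroup.mem_top (⟨v, 0⟩ : BaerGroup c) : _ ∈ comapFst c _)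

theorem finite_of_fg [Group.FG (BaerGroup c)] : Module.Finite (ZMod p) V := by
  classical
  obtain ⟨S, -, hS⟩ := Group.rank_spec (BaerGroup c)
  exact ⟨⟨S.image fst, by simpa using span_image_fst_eq_top hS⟩⟩

variable [NeZero (2 : ZMod p)]

theorem eq_top_of_mk_mem (hc : c.IsAlt) (hs : Submodule.map₂ c ⊤ ⊤ = ⊤) {ι : Type*} {b : ι → V}
    (hb : Submodule.span (ZMod p) (Set.range b) = ⊤) {H : Subgroup (BaerGroup c)}
    (hH : ∀ i, ⟨b i, 0⟩ ∈ H) : H = ⊤ := by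
  have exists_mem (v : V) : ∃ u, ⟨v, u⟩ ∈ H := by
    have hv : v ∈ Submodule.span (ZMod p) (Set.range b) := hb ▸ Submodule.mem_top
    induction hv using Submodule.span_induction with
    | mem v hv => obtain ⟨i, rfl⟩ := hv; exact ⟨0, hH i⟩
    | zero => exact ⟨0, H.one_mem⟩
    | add v w _ _ hv hw =>
      obtain ⟨a, ha⟩ := hv
      obtain ⟨b, hb⟩ := hw
      exact ⟨_, H.mul_mem ha hb⟩
    | smul r v _ hv =>
      obtain ⟨a, ha⟩ := hv
      refine ⟨r.val • a, ?_⟩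
      simpa only [pow_eq hc, ← Nat.cast_smul_eq_nsmul (ZMod p) r.val v, ZMod.natCast_zmod_val]
        using H.pow_mem ha r.val
  have commutator_mem (v w : V) : ⟨0, c v w⟩ ∈ H := by
    obtain ⟨a, ha⟩ := exists_mem v
    obtain ⟨b, hb⟩ := exists_mem w
    rw [← commutator_eq hc ⟨v, a⟩ ⟨w, b⟩, commutatorElement_def]
    exact H.mul_mem (H.mul_mem (H.mul_mem ha hb) (H.inv_mem ha)) (H.inv_mem hb)
  refine eq_top_iff.2 fun ⟨v, u⟩ _ => ?_
  obtain ⟨a, ha⟩ := exists_mem v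
  convert H.mul_mem ha (mk_zero_mem hs commutator_mem (u - a)) using 1
  ext <;> simp

theorem rank_eq_finrank (hc : c.IsAlt) (hs : Submodule.map₂ c ⊤ ⊤ = ⊤)
    [Group.FG (BaerGroup c)] : Group.rank (BaerGroup c) = finrank (ZMod p) V := by
  classical
  have := finite_of_fg (c := c)
  apply le_antisymm
  · let b := finBasis (ZMod p) V
    have generates : Subgroup.closure
        (Finset.univ.image fun i => (⟨b i, 0⟩ : BaerGroup c) : Set (BaerGroup c)) = ⊤ :=
      eq_top_of_mk_mem hc hs b.span_eq fun i => Subgroup.subset_closure (by simp)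
    exact (Group.rank_le generates).trans (Finset.card_image_le.trans_eq (by simp))
  · obtain ⟨S, hcard, hS⟩ := Group.rank_spec (BaerGroup c)
    rw [← hcard, ← finrank_top, ← span_image_fst_eq_top hS, ← Finset.coe_image]
    exact (finrank_span_finset_le_card _).trans Finset.card_image_le

end ZMod

end BaerGroup

instance neZero_two_zmod_of_odd {p : ℕ} [Fact p.Prime] [hp : Fact (Odd p)] :
    NeZero (2 : ZMod p) :=
  ⟨Ring.two_ne_zero (by rw [ZMod.ringChar_zmod_n]; exact hp.out.ne_two_of_dvd_nat dvd_rfl)⟩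

/-- Groups of class at most two in which `x ^ p = 1`. -/
class IsClassTwoExp (p : ℕ) (G : Type*) [Group G] : Prop where
  commute_commutator : ∀ x y z : G, Commute ⁅x, y⁆ z
  pow_eq_one : ∀ x : G, x ^ p = 1

theorem isClassLE_two_iff {G : Type*} [Group G] :
    IsClassLE 2 G ↔ ∀ x y z : G, Commute ⁅x, y⁆ z := by
  have lowerCentralSeries_two : IsClassLE 2 G ↔ ⁅⁅(⊤ : Subgroup G), ⊤⁆, (⊤ : Subgroup G)⁆ = ⊥ :=
    Iff.rfl
  simp only [lowerCentralSeries_two, Subgroup.commutator_top_right_eq_bot_iff_le_center,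
    Subgroup.commutator_le, Subgroup.mem_top, Subgroup.mem_center_iff, forall_const]
  exact forall₃_congr fun _ _ _ => eq_comm

theorem BaerGroup.isClassTwoExp {p : ℕ} [Fact p.Prime] [NeZero (2 : ZMod p)] {V U : Type*}
    [AddCommGroup V] [Module (ZMod p) V] [AddCommGroup U] [Module (ZMod p) U]
    {c : V →ₗ[ZMod p] V →ₗ[ZMod p] U} (hc : c.IsAlt) : IsClassTwoExp p (BaerGroup c) where
  commute_commutator x y z := by
    rw [commutator_eq hc]
    exact (Subgroup.mem_center_iff.1 (mk_zero_mem_center hc _) z).symm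
  pow_eq_one := pow_prime_eq_one hc

namespace IsClassTwoExp

section HalfCommutator

variable (p : ℕ) {G : Type*} [Group G]

/-- The square root of the commutator `[x, y]` in a group of class two and odd exponent `p`. -/
def halfCommutator (x y : G) : G := ⁅x, y⁆ ^ ((p + 1) / 2)

theorem halfCommutator_swap (x y : G) : halfCommutator p y x = (halfCommutator p x y)⁻¹ := by
  rw [halfCommutator, ← commutatorElement_inv, inv_pow, halfCommutator]

theorem halfCommutator_eq_one_of_commute {x y : G} (hxy : Commute x y) :
    halfCommutator p x y = 1 := by
  rw [halfCommutator, hxy.commutator_eq, one_pow]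

variable [IsClassTwoExp p G]

theorem commutator_mul_left (p : ℕ) {G : Type*} [Group G] [IsClassTwoExp p G] (x y z : G) :
    ⁅x * y, z⁆ = ⁅x, z⁆ * ⁅y, z⁆ := by
  rw [commutatorElement_mul_left_eq_conj_mul,
    (commute_commutator p y z x).symm.mul_inv_cancel, (commute_commutator p y z _).eq]

theorem commute_halfCommutator (x y z : G) : Commute (halfCommutator p x y) z :=
  (commute_commutator p x y z).pow_left _

theorem halfCommutator_mul_left (x y z : G) :
    halfCommutator p (x * y) z = halfCommutator p x z * halfCommutator p y z := by
  rw [halfCommutator, commutator_mul_left p, (commute_commutator p x z _).mul_pow, halfCommutator,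
    halfCommutator]

theorem halfCommutator_mul_right (x y z : G) :
    halfCommutator p x (y * z) = halfCommutator p x y * halfCommutator p x z := by
  rw [halfCommutator_swap, halfCommutator_mul_left, mul_inv_rev, ← halfCommutator_swap,
    ← halfCommutator_swap, (commute_halfCommutator p x y _).eq]

theorem halfCommutator_mul_self [hp : Fact (Odd p)] (x y : G) :
    halfCommutator p x y * halfCommutator p x y = ⁅x, y⁆ := by
  obtain ⟨k, rfl⟩ := hp.out
  rw [halfCommutator, ← pow_add,
    show (2 * k + 1 + 1) / 2 + (2 * k + 1 + 1) / 2 = 2 * k + 1 + 1 by omega, pow_succ,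
    pow_eq_one, one_mul]

end HalfCommutator

end IsClassTwoExp

open IsClassTwoExp

/-- The Lie ring of the Baer correspondence: the underlying set of `G` with the addition
`x + y = [y, x]^(1/2) x y` and the commutator as its bracket. The exponent `p` is a parameter
because the addition depends on it. -/
def BaerLie (_p : ℕ) (G : Type*) := G

namespace BaerLie

variable (p : ℕ) {G : Type*} [Group G]

/-- The identity map from a group to its Lie ring. -/
def of : G ≃ BaerLie p G := Equiv.refl _

instance : Add (BaerLie p G) :=
  ⟨fun x y => of p (halfCommutator p ((of p).symm y) ((of p).symm x) *
    ((of p).symm x * (of p).symm y))⟩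

instance : Zero (BaerLie p G) := ⟨of p 1⟩

instance : Neg (BaerLie p G) := ⟨fun x => of p ((of p).symm x)⁻¹⟩

theorem of_one : of p (1 : G) = 0 := rfl

theorem of_inv (x : G) : of p x⁻¹ = -of p x := rfl

theorem of_add_of (x y : G) : of p x + of p y = of p (halfCommutator p y x * (x * y)) := rfl

theorem of_mul_of_commute {x y : G} (hxy : Commute x y) : of p (x * y) = of p x + of p y := by
  rw [of_add_of, halfCommutator_eq_one_of_commute p hxy.symm, one_mul]

variable [IsClassTwoExp p G]

theorem halfCommutator_halfCommutator_left (x y z : G) :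
    halfCommutator p (halfCommutator p x y) z = 1 :=
  halfCommutator_eq_one_of_commute p (commute_halfCommutator p x y z)

theorem halfCommutator_halfCommutator_right (x y z : G) :
    halfCommutator p x (halfCommutator p y z) = 1 :=
  halfCommutator_eq_one_of_commute p (commute_halfCommutator p y z x).symm

protected theorem add_assoc (x y z : BaerLie p G) : x + y + z = x + (y + z) := by
  obtain ⟨x, rfl⟩ := (of p (G := G)).surjective x
  obtain ⟨y, rfl⟩ := (of p (G := G)).surjective y
  obtain ⟨z, rfl⟩ := (of p (G := G)).surjective z
  simp only [of_add_of, halfCommutator_halfCommutator_left, halfCommutator_halfCommutator_right,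
    halfCommutator_mul_left, halfCommutator_mul_right, one_mul, mul_assoc]
  rw [(commute_halfCommutator p z y (halfCommutator p y x)).left_comm,
    (commute_halfCommutator p z y x).left_comm,
    (commute_halfCommutator p z x (halfCommutator p y x)).left_comm]

theorem of_commutator_add_left (x y z : G) :
    of p ⁅(of p).symm (of p x + of p y), z⁆ = of p ⁅x, z⁆ + of p ⁅y, z⁆ := by
  rw [of_add_of, Equiv.symm_apply_apply, commutator_mul_left p,
    (commute_halfCommutator p y x z).commutator_eq, one_mul, commutator_mul_left p,
    of_mul_of_commute p (commute_commutator p x z _)]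

variable [Fact (Odd p)]

protected theorem add_comm (x y : BaerLie p G) : x + y = y + x := by
  obtain ⟨x, rfl⟩ := (of p (G := G)).surjective x
  obtain ⟨y, rfl⟩ := (of p (G := G)).surjective y
  have mul_eq : x * y = halfCommutator p x y * (halfCommutator p x y * (y * x)) := by
    rw [← mul_assoc, halfCommutator_mul_self, commutatorElement_def]
    group
  rw [of_add_of, of_add_of, mul_eq, halfCommutator_swap p x y, inv_mul_cancel_left]

instance : AddCommGroup (BaerLie p G) where
  add_assoc := BaerLie.add_assoc p
  zero_add x := (of_mul_of_commute p (.one_left ((of p).symm x))).symm.trans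
    (congrArg (of p) (one_mul ((of p).symm x)))
  add_zero x := (of_mul_of_commute p (.one_right ((of p).symm x))).symm.trans
    (congrArg (of p) (mul_one ((of p).symm x)))
  neg_add_cancel x :=
    (of_mul_of_commute p (Commute.refl ((of p).symm x)).inv_left).symm.trans
    (congrArg (of p) (inv_mul_cancel ((of p).symm x)))
  add_comm := BaerLie.add_comm p
  nsmul := nsmulRec
  zsmul := zsmulRec

theorem of_pow (x : G) (n : ℕ) : of p (x ^ n) = n • of p x := by
  induction n with
  | zero => rw [pow_zero, zero_nsmul, of_one]
  | succ n ih => rw [pow_succ, of_mul_of_commute p (.pow_self x n), ih, succ_nsmul]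

instance : Module (ZMod p) (BaerLie p G) :=
  AddCommGroup.zmodModule fun x => by
    have := of_pow p ((of p).symm x : G) p
    rwa [pow_eq_one, of_one, Equiv.apply_symm_apply, eq_comm] at this

theorem of_commutator_add_right (x y z : G) :
    of p ⁅x, (of p).symm (of p y + of p z)⁆ = of p ⁅x, y⁆ + of p ⁅x, z⁆ := by
  rw [← commutatorElement_inv, of_inv, of_commutator_add_left, neg_add, ← of_inv, ← of_inv,
    commutatorElement_inv, commutatorElement_inv]

/-- The Lie bracket of the Baer correspondence, given by the group commutator. -/
def bracket : BaerLie p G →ₗ[ZMod p] BaerLie p G →ₗ[ZMod p] BaerLie p G :=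
  AddMonoidHom.toZModLinearMap p <|
    AddMonoidHom.mk'
      (fun x => AddMonoidHom.toZModLinearMap p <|
        AddMonoidHom.mk' (fun y => of p ⁅(of p).symm x, (of p).symm y⁆) fun _ _ =>
          of_commutator_add_right p (G := G) _ _ _)
      fun _ _ => LinearMap.ext fun _ => of_commutator_add_left p (G := G) _ _ _

theorem bracket_of (x y : G) : bracket p (of p x) (of p y) = of p ⁅x, y⁆ := rfl

theorem isAlt_bracket : (bracket p (G := G)).IsAlt := fun x => by
  obtain ⟨x, rfl⟩ := (of p (G := G)).surjective x
  rw [bracket_of, commutatorElement_self, of_one]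

theorem bracket_bracket (x y z : BaerLie p G) : bracket p (bracket p x y) z = 0 := by
  obtain ⟨x, rfl⟩ := (of p (G := G)).surjective x
  obtain ⟨y, rfl⟩ := (of p (G := G)).surjective y
  obtain ⟨z, rfl⟩ := (of p (G := G)).surjective z
  rw [bracket_of, bracket_of, (commute_commutator p x y z).commutator_eq, of_one]

theorem of_mul [Fact p.Prime] (x y : G) :
    of p (x * y) = of p x + of p y + (2⁻¹ : ZMod p) • bracket p (of p x) (of p y) := by
  have of_halfCommutator : (2⁻¹ : ZMod p) • bracket p (of p x) (of p y) =
      of p (halfCommutator p x y) := by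
    rw [bracket_of, ← halfCommutator_mul_self p, of_mul_of_commute p (.refl _), ← two_smul (ZMod p),
      inv_smul_smul₀ two_ne_zero]
  rw [of_halfCommutator, add_comm, of_add_of p x y,
    ← of_mul_of_commute p (commute_halfCommutator p x y _), halfCommutator_swap p x y,
    mul_inv_cancel_left]

section Lift

variable {V U : Type*} [AddCommGroup V] [Module (ZMod p) V] [AddCommGroup U] [Module (ZMod p) U]
  {c : V →ₗ[ZMod p] V →ₗ[ZMod p] U} {p} (f : V →ₗ[ZMod p] BaerLie p G)
  (g : U →ₗ[ZMod p] BaerLie p G)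

theorem bracket_apply_eq_zero {f : V → BaerLie p G} {g : U →ₗ[ZMod p] BaerLie p G}
    (hfg : ∀ v w, g (c v w) = bracket p (f v) (f w))
    (hs : Submodule.map₂ c ⊤ ⊤ = ⊤) (u : U) : bracket p (g u) = 0 := by
  have : Submodule.map₂ c ⊤ ⊤ ≤ LinearMap.ker (bracket p ∘ₗ g) :=
    Submodule.map₂_le.2 fun v _ w _ => LinearMap.ext fun x => by
      rw [LinearMap.comp_apply, hfg, bracket_bracket, LinearMap.zero_apply]
  exact this (hs ▸ Submodule.mem_top)

variable [Fact p.Prime] (hg : ∀ u, bracket p (g u) = 0)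
  (hfg : ∀ v w, g (c v w) = bracket p (f v) (f w))

/-- The homomorphism from a Baer group to `G` induced by linear maps to the Lie ring of `G` that are
compatible with the brackets. -/
def lift : BaerGroup c →* G :=
  MonoidHom.mk' (fun x => (of p).symm (f x.fst + g x.snd)) fun x y => by
    apply (of p).injective
    have hg' (u : U) (x : BaerLie p G) : bracket p x (g u) = 0 :=
      (isAlt_bracket p).eq_iff.1 (by rw [hg, LinearMap.zero_apply])
    simp only [of_mul, Equiv.apply_symm_apply, BaerGroup.mul_fst, BaerGroup.mul_snd, map_add, hg,
      hg', add_zero, map_smul, hfg]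
    abel

theorem of_lift (x : BaerGroup c) : of p (lift f g hg hfg x) = f x.fst + g x.snd := rfl

end Lift

variable (G) in
/-- The derived subalgebra of the Lie ring. -/
def derived : Submodule (ZMod p) (BaerLie p G) := Submodule.map₂ (bracket p) ⊤ ⊤

theorem bracket_mem_derived (x y : BaerLie p G) : bracket p x y ∈ derived p G :=
  Submodule.apply_mem_map₂ _ Submodule.mem_top Submodule.mem_top

theorem bracket_eq_zero_of_mem_derived {x : BaerLie p G} (hx : x ∈ derived p G) :
    bracket p x = 0 := by
  have : derived p G ≤ LinearMap.ker (bracket p (G := G)) :=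
    Submodule.map₂_le.2 fun x _ y _ => LinearMap.ext (bracket_bracket p x y)
  exact this hx

variable {p} {W : Submodule (ZMod p) (BaerLie p G)}

theorem derived_eq_map₂_of_isCompl (hW : IsCompl (derived p G) W) :
    derived p G = Submodule.map₂ (bracket p) W W := by
  have derived_left (W) : Submodule.map₂ (bracket p (G := G)) (derived p G) W = ⊥ :=
    eq_bot_iff.2 <| Submodule.map₂_le.2 fun x hx y _ => by
      rw [bracket_eq_zero_of_mem_derived p hx, LinearMap.zero_apply, Submodule.mem_bot]
  have derived_right (W) : Submodule.map₂ (bracket p (G := G)) W (derived p G) = ⊥ :=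
    eq_bot_iff.2 <| Submodule.map₂_le.2 fun x _ y hy => by
      rw [Submodule.mem_bot, (isAlt_bracket p).eq_iff, bracket_eq_zero_of_mem_derived p hy,
        LinearMap.zero_apply]
  conv_lhs => rw [derived, ← hW.sup_eq_top]
  simp only [Submodule.map₂_sup_left, Submodule.map₂_sup_right, derived_left, derived_right,
    bot_sup_eq]

variable (W) in
/-- The restriction of the bracket to a subspace, with values in the derived subalgebra. -/
def bracketOn : W →ₗ[ZMod p] W →ₗ[ZMod p] derived p G :=
  LinearMap.mk₂ (ZMod p) (fun x y => ⟨bracket p (x : BaerLie p G) y, bracket_mem_derived p _ _⟩)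
    (fun _ _ _ => Subtype.ext (by simp)) (fun _ _ _ => Subtype.ext (by simp))
    (fun _ _ _ => Subtype.ext (by simp)) (fun _ _ _ => Subtype.ext (by simp))

theorem map₂_bracketOn_eq_top (hW : IsCompl (derived p G) W) :
    Submodule.map₂ (bracketOn W) ⊤ ⊤ = ⊤ := by
  apply Submodule.map_injective_of_injective (derived p G).injective_subtype
  have bracketOn_eq : (bracketOn W).compr₂ (derived p G).subtype =
      (bracket p).compl₁₂ W.subtype W.subtype := rfl
  rw [Submodule.map_map₂, bracketOn_eq, ← Submodule.map₂_map_map, W.map_subtype_top,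
    Submodule.map_subtype_top, derived_eq_map₂_of_isCompl hW]

theorem nonempty_mulEquiv_baerGroup [Fact p.Prime] (hW : IsCompl (derived p G) W) :
    Nonempty (G ≃* BaerGroup (bracketOn W)) := by
  let φ : BaerGroup (bracketOn W) →* G :=
    lift W.subtype (derived p G).subtype (fun u => bracket_eq_zero_of_mem_derived p u.2)
      fun _ _ => rfl
  have of_φ (x) : of p (φ x) = W.prodEquivOfIsCompl _ hW.symm (BaerGroup.equivProd _ x) := rfl
  have bijective : Function.Bijective (of p ∘ φ) := by
    rw [show of p ∘ φ = _ from funext of_φ]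
    exact (W.prodEquivOfIsCompl _ hW.symm).bijective.comp (BaerGroup.equivProd _).bijective
  exact ⟨(MulEquiv.ofBijective φ ((of p).comp_bijective φ |>.1 bijective)).symm⟩

end BaerLie

theorem IsClassTwoExp.exists_mulEquiv_baerGroup (p : ℕ) [Fact p.Prime] [Fact (Odd p)]
    (G : Type*) [Group G] [IsClassTwoExp p G] :
    ∃ (V U : Submodule (ZMod p) (BaerLie p G)) (c : V →ₗ[ZMod p] V →ₗ[ZMod p] U),
      c.IsAlt ∧ Submodule.map₂ c ⊤ ⊤ = ⊤ ∧ Nonempty (G ≃* BaerGroup c) := by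
  obtain ⟨W, hW⟩ := (BaerLie.derived p G).exists_isCompl
  exact ⟨W, BaerLie.derived p G, BaerLie.bracketOn W,
    fun x => Subtype.ext (BaerLie.isAlt_bracket p _), BaerLie.map₂_bracketOn_eq_top hW,
    BaerLie.nonempty_mulEquiv_baerGroup hW⟩

theorem isCapable_of_ker {G : Type u} [Group G] {K : Type w} [Group K] [Small.{v} K] (π : K →* G)
    (hπ : Function.Surjective π) (hk : π.ker = Subgroup.center K) : IsCapable.{u, v} G := by
  let σ : Shrink.{v} K ≃* K := Shrink.mulEquiv
  have ker_eq : (π.comp σ.toMonoidHom).ker = Subgroup.center (Shrink.{v} K) := by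
    ext x
    rw [MonoidHom.mem_ker, MonoidHom.comp_apply, ← MonoidHom.mem_ker, hk]
    simp [Subgroup.mem_center_iff, σ.surjective.forall, ← map_mul]
  exact ⟨_, _, ⟨((QuotientGroup.quotientMulEquivOfEq ker_eq.symm).trans
    (QuotientGroup.quotientKerEquivOfSurjective _ (hπ.comp σ.surjective))).symm⟩⟩

theorem IsCapable.of_mulEquiv {G : Type u} [Group G] {G' : Type w} [Group G'] (e : G ≃* G')
    (h : IsCapable.{w, v} G') : IsCapable.{u, v} G := by
  obtain ⟨K, _, ⟨φ⟩⟩ := h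
  exact ⟨K, inferInstance, ⟨e.trans φ⟩⟩

/-- The central extension of `H` by `Z` defined by a function `f : H × H → Z`. -/
@[ext]
structure CocycleExtension {H Z : Type*} (f : H → H → Z) where
  fst : H
  snd : Z

namespace CocycleExtension

variable {H Z : Type*} {f : H → H → Z}

instance [Small.{v} H] [Small.{v} Z] : Small.{v} (CocycleExtension f) :=
  small_of_injective (f := fun x => (x.fst, x.snd)) fun _ _ h =>
    CocycleExtension.ext (congrArg Prod.fst h) (congrArg Prod.snd h)

variable [Group H] [AddCommGroup Z]

/-- The group structure given by a normalized 2-cocycle. -/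
abbrev group (h1 : ∀ x, f 1 x = 0) (hf : ∀ x y z, f x y + f (x * y) z = f y z + f x (y * z)) :
    Group (CocycleExtension f) :=
  letI : One (CocycleExtension f) := ⟨⟨1, 0⟩⟩
  letI : Mul (CocycleExtension f) := ⟨fun x y => ⟨x.fst * y.fst, x.snd + y.snd + f x.fst y.fst⟩⟩
  letI : Inv (CocycleExtension f) := ⟨fun x => ⟨x.fst⁻¹, -x.snd - f x.fst⁻¹ x.fst⟩⟩
  Group.ofLeftAxioms
    (fun x y z => CocycleExtension.ext (mul_assoc _ _ _) <| by
      change x.snd + y.snd + f x.fst y.fst + z.snd + f (x.fst * y.fst) z.fst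
        = x.snd + (y.snd + z.snd + f y.fst z.fst) + f x.fst (y.fst * z.fst)
      rw [eq_sub_of_add_eq (hf x.fst y.fst z.fst)]
      abel)
    (fun x => CocycleExtension.ext (one_mul _) <| by
      change 0 + x.snd + f 1 x.fst = x.snd
      rw [h1, zero_add, add_zero])
    (fun x => CocycleExtension.ext (inv_mul_cancel _) <| by
      change -x.snd - f x.fst⁻¹ x.fst + x.snd + f x.fst⁻¹ x.fst = 0
      abel)

end CocycleExtension

theorem isCapable_of_cocycle {H : Type u} {Z : Type w} [Group H] [AddCommGroup Z] [Small.{v} H]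
    [Small.{v} Z] (f : H → H → Z) (h1 : ∀ x, f 1 x = 0) (h1' : ∀ x, f x 1 = 0)
    (hf : ∀ x y z, f x y + f (x * y) z = f y z + f x (y * z))
    (hn : ∀ x, (∀ y, x * y = y * x ∧ f x y = f y x) → x = 1) : IsCapable.{u, v} H := by
  let _ := CocycleExtension.group h1 hf
  let π : CocycleExtension f →* H := MonoidHom.mk' CocycleExtension.fst fun x y => rfl
  refine isCapable_of_ker π (fun x => ⟨⟨x, 0⟩, rfl⟩) ?_
  have commute_iff (x y : CocycleExtension f) : y * x = x * y ↔
      y.fst * x.fst = x.fst * y.fst ∧ y.snd + x.snd + f y.fst x.fst =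
        x.snd + y.snd + f x.fst y.fst := CocycleExtension.ext_iff
  ext x
  simp only [MonoidHom.mem_ker, Subgroup.mem_center_iff, commute_iff, add_comm x.snd,
    add_right_inj]
  constructor
  · intro hx y
    replace hx : x.fst = 1 := hx
    rw [hx, one_mul, mul_one, h1, h1']
    exact ⟨rfl, rfl⟩
  · exact fun hx => hn x.fst fun y => ⟨(hx ⟨y, 0⟩).1.symm, (hx ⟨y, 0⟩).2.symm⟩

section Cochain

variable {F V U ι : Type*} [Field F] [AddCommGroup V] [Module F V] [AddCommGroup U] [Module F U]
  {c : V →ₗ[F] V →ₗ[F] U} {β : U →ₗ[F] V →ₗ[F] F}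

/-- The cyclic sum whose vanishing is the Jacobi identity. -/
def jac (c : V →ₗ[F] V →ₗ[F] U) (β : U →ₗ[F] V →ₗ[F] F) (x y z : V) : F :=
  β (c x y) z + β (c y z) x + β (c z x) y

/-- The Jacobi identity for a bilinear form `β : U × V → F` relative to `c : V × V → U`.
Such a `β` describes the commutators of lifts of elements of `U` and of `V` in a central extension
of the Baer group of `c` by `F`. -/
def IsJacobi (c : V →ₗ[F] V →ₗ[F] U) (β : U →ₗ[F] V →ₗ[F] F) : Prop :=
  ∀ x y z, jac c β x y z = 0

/-- The vectors `u` of this kind are central in every lift of the Baer group of `c` to a central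
extension, as `β u` describes the commutators of the lifts of `u`; they obstruct capability. -/
def IsEpicentral (c : V →ₗ[F] V →ₗ[F] U) (u : U) : Prop := ∀ β, IsJacobi c β → β u = 0

-- The coefficient of `B` at `(i, j, k)` sorts the last two indices, and is then the coefficient of
-- `β (c x y) z` if the middle index does not exceed the first one, and zero otherwise.
theorem IsJacobi.exists_trilinear [LinearOrder ι] (b : Basis ι F V) (hc : c.IsAlt)
    (hβ : IsJacobi c β) : ∃ B : V →ₗ[F] V →ₗ[F] V →ₗ[F] F,
      (∀ x y z, B x y z = B x z y) ∧ ∀ x y z, B x y z - B y x z = β (c x y) z := by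
  let D (i j k : ι) : F := β (c (b i) (b j)) (b k)
  have D_swap (i j k) : D i j k = -D j i k := by
    simp only [D, ← hc.neg (b j) (b i), map_neg, LinearMap.neg_apply]
  have D_self (i k) : D i i k = 0 := by simp [D, hc.self_eq_zero]
  have D_jacobi (i j k) : D i j k + D j k i + D k i j = 0 := hβ _ _ _
  let B : V →ₗ[F] V →ₗ[F] V →ₗ[F] F :=
    b.constr F fun i => b.constr F fun j => b.constr F fun k =>
      if j ≤ k then (if j ≤ i then D i j k else 0) else (if k ≤ i then D i k j else 0)
  have B_basis (i j k) : B (b i) (b j) (b k) =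
      if j ≤ k then (if j ≤ i then D i j k else 0) else (if k ≤ i then D i k j else 0) := by
    simp only [B, Basis.constr_basis]
  have B_swap_right : B = LinearMap.lflip.toLinearMap ∘ₗ B :=
    b.ext fun i => b.ext fun j => b.ext fun k => by
    rw [LinearMap.comp_apply, LinearEquiv.coe_coe, LinearMap.lflip_apply, LinearMap.flip_apply,
      B_basis, B_basis]
    rcases lt_trichotomy j k with h | rfl | h
    · rw [if_pos h.le, if_neg h.not_ge]
    · rfl
    · rw [if_neg h.not_ge, if_pos h.le]
  have B_eq_flip_add : B = B.flip + c.compr₂ β :=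
    b.ext fun i => b.ext fun j => b.ext fun k => by
    rw [LinearMap.add_apply, LinearMap.add_apply, LinearMap.add_apply, LinearMap.flip_apply,
      B_basis, B_basis, LinearMap.compr₂_apply, ← show D i j k = β (c (b i) (b j)) (b k) from rfl]
    grind [D_jacobi i j k, D_swap i j k, D_swap j k i, D_swap k i j, D_self i k,
      D_self j i, D_self k j]
  exact ⟨B, fun x y z => LinearMap.congr_fun₂ (LinearMap.congr_fun B_swap_right x) y z,
    fun x y z => sub_eq_of_eq_add' <|
      LinearMap.congr_fun (LinearMap.congr_fun₂ B_eq_flip_add x y) z⟩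

theorem IsJacobi.exists_cochain [LinearOrder ι] (b : Basis ι F V) (hc : c.IsAlt)
    (hβ : IsJacobi c β) : ∃ g : V → V → F, (∀ x, g 0 x = 0) ∧ (∀ x, g x 0 = 0) ∧
      ∀ x y z, 2⁻¹ * β (c x y) z = g y z + g x (y + z) - g x y - g (x + y) z := by
  obtain ⟨B, B_swap_right, B_sub_swap⟩ := hβ.exists_trilinear b hc
  refine ⟨fun x y => 2⁻¹ * (B x x y + B x y y), fun x => by simp, fun x => by simp,
    fun x y z => ?_⟩
  rw [← B_sub_swap]
  simp only [map_add, LinearMap.add_apply, B_swap_right x z y]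
  ring

theorem BaerGroup.isCapable {F V U ι : Type*} [Field F] [AddCommGroup V] [Module F V]
    [AddCommGroup U] [Module F U] [Small.{v} F] [Small.{v} V] [Small.{v} U] [Nontrivial ι]
    (b : Basis ι F V) {c : V →ₗ[F] V →ₗ[F] U} (hc : c.IsAlt)
    (h : ∀ u, IsEpicentral c u → u = 0) : IsCapable.{_, v} (BaerGroup c) := by
  classical
  let _ : LinearOrder ι := linearOrderOfSTO WellOrderingRel
  choose g g_zero_left g_zero_right coboundary_g using fun β : {β // IsJacobi c β} =>
    β.2.exists_cochain b hc
  let f (x y : BaerGroup c) : ({β // IsJacobi c β} → F) × (ι → ι → F) :=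
    (fun β => β.1 x.snd y.fst + g β x.fst y.fst, fun i j => b.repr x.fst i * b.repr y.fst j)
  have cocycle_f (x y z) : f x y + f (x * y) z = f y z + f x (y * z) := by
    refine Prod.ext (funext fun β => ?_) (funext fun i => funext fun j => ?_)
    · have := coboundary_g β x.fst y.fst z.fst
      simp only [f, Prod.fst_add, Pi.add_apply, mul_fst, mul_snd, map_add, LinearMap.add_apply,
        map_smul, LinearMap.smul_apply, smul_eq_mul]
      linear_combination this
    · simp only [f, Prod.snd_add, Pi.add_apply, mul_fst, map_add, Finsupp.add_apply]
      ring
  have : Small.{v} ι := small_of_injective b.injective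
  have : Small.{v} (U →ₗ[F] V →ₗ[F] F) :=
    have : Small.{v} (V →ₗ[F] F) := small_of_injective DFunLike.coe_injective
    small_of_injective DFunLike.coe_injective
  have : Small.{v} (BaerGroup c) := small_map (equivProd c)
  refine isCapable_of_cocycle f (fun x => ?_) (fun x => ?_) cocycle_f fun x hx => ?_
  · ext <;> simp [f, g_zero_left]
  · ext <;> simp [f, g_zero_right]
  · have fst_eq_zero : x.fst = 0 := b.ext_elem fun i => by
      obtain ⟨j, hj⟩ := exists_ne i
      simpa [f, hj] using congrFun₂ (congrArg Prod.snd (hx ⟨b j, 0⟩).2) i j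
    refine BaerGroup.ext fst_eq_zero (h _ fun β hβ => LinearMap.ext fun w => ?_)
    simpa [f, fst_eq_zero, g_zero_left, g_zero_right] using
      congrFun (congrArg Prod.fst (hx ⟨w, 0⟩).2) ⟨β, hβ⟩

end Cochain

theorem commutator_le_centralizer_of_commutator_le_center {K : Type*} [Group K] {A B : Subgroup K}
    (h : ⁅A, B⁆ ≤ Subgroup.center K) : ⁅A, A⁆ ≤ Subgroup.centralizer B := by
  have commutator_commutator (H : Subgroup K) : ⁅⁅A, B⁆, H⁆ = ⊥ :=
    Subgroup.commutator_eq_bot_iff_le_centralizer.2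
      (h.trans (Subgroup.center_le_centralizer _))
  rw [← Subgroup.commutator_eq_bot_iff_le_centralizer]
  refine Subgroup.commutator_commutator_eq_bot_of_rotate (commutator_commutator A) ?_
  rw [Subgroup.commutator_comm B A, commutator_commutator]

theorem IsCapable.exists_ker_eq_center {G : Type u} [Group G] (h : IsCapable.{u, v} G) :
    ∃ (K : Type v) (_ : Group K) (π : K →* G),
      Function.Surjective π ∧ π.ker = Subgroup.center K := by
  obtain ⟨K, _, ⟨e⟩⟩ := h
  let π : K →* G := (e.symm : _ →* G).comp (QuotientGroup.mk' (Subgroup.center K))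
  refine ⟨K, inferInstance, π, e.symm.surjective.comp (QuotientGroup.mk'_surjective _), ?_⟩
  rw [MonoidHom.ker_mulEquiv_comp, QuotientGroup.ker_mk']

-- In a group `K` with `K / Z(K) ≃ G`, the preimages of `A` and `B` commute modulo the center. So
-- lifts of `[a, a']` centralize the preimage of `B`, and lifts of `[b, b']` that of `A`.
theorem IsCapable.commutator_eq_one_of_commutator_eq {G : Type u} [Group G]
    (hG : IsCapable.{u, v} G) {A B : Subgroup G} (hsup : A ⊔ B = ⊤) (hAB : ⁅A, B⁆ = ⊥)
    {a a' b b' : G} (ha : a ∈ A) (ha' : a' ∈ A) (hb : b ∈ B) (hb' : b' ∈ B)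
    (h : ⁅a, a'⁆ = ⁅b, b'⁆) : ⁅a, a'⁆ = 1 := by
  obtain ⟨K, _, π, π_surjective, ker_π⟩ := hG.exists_ker_eq_center
  have comap_commutator_le : ⁅A.comap π, B.comap π⁆ ≤ Subgroup.center K :=
    Subgroup.commutator_le.2 fun x hx y hy => by
      rw [← ker_π, MonoidHom.mem_ker, map_commutatorElement, ← Subgroup.mem_bot, ← hAB]
      exact Subgroup.commutator_mem_commutator hx hy
  have comap_commutator_le' : ⁅B.comap π, A.comap π⁆ ≤ Subgroup.center K :=
    (Subgroup.commutator_comm _ _).trans_le comap_commutator_le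
  obtain ⟨a, rfl⟩ := π_surjective a
  obtain ⟨a', rfl⟩ := π_surjective a'
  obtain ⟨b, rfl⟩ := π_surjective b
  obtain ⟨b', rfl⟩ := π_surjective b'
  have commutator_mem_centralizer : ⁅a, a'⁆ ∈ Subgroup.centralizer (B.comap π : Set K) :=
    commutator_le_centralizer_of_commutator_le_center comap_commutator_le
      (Subgroup.commutator_mem_commutator ha ha')
  have commutator_mem_centralizer' : ⁅b, b'⁆ ∈ Subgroup.centralizer (A.comap π : Set K) :=
    commutator_le_centralizer_of_commutator_le_center comap_commutator_le'
      (Subgroup.commutator_mem_commutator hb hb')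
  have commutator_eq_mul : ∃ z ∈ Subgroup.center K, ⁅a, a'⁆ = z * ⁅b, b'⁆ := by
    refine ⟨⁅a, a'⁆ / ⁅b, b'⁆, ?_, (div_mul_cancel _ _).symm⟩
    rw [← ker_π, MonoidHom.mem_ker, map_div, map_commutatorElement, map_commutatorElement, h,
      div_self']
  have mem_centralizer_comap : ⁅a, a'⁆ ∈ Subgroup.centralizer (A.comap π : Set K) := by
    obtain ⟨z, hz, hzb⟩ := commutator_eq_mul
    exact hzb ▸ mul_mem (Subgroup.center_le_centralizer _ hz) commutator_mem_centralizer'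
  have top_le_centralizer : ⊤ ≤ Subgroup.centralizer {⁅a, a'⁆} := by
    rw [← Subgroup.comap_top π, ← hsup, ← Subgroup.comap_sup_eq _ _ _ π_surjective]
    exact sup_le
      (fun x hx => Subgroup.mem_centralizer_singleton_iff.2 (mem_centralizer_comap x hx))
      (fun y hy => Subgroup.mem_centralizer_singleton_iff.2 (commutator_mem_centralizer y hy))
  rw [← map_commutatorElement, ← MonoidHom.mem_ker, ker_π]
  exact Subgroup.mem_center_iff.2 fun k =>
    Subgroup.mem_centralizer_singleton_iff.1 (top_le_centralizer (Subgroup.mem_top k))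

theorem BaerGroup.not_isCapable {F V U : Type*} [Field F] [NeZero (2 : F)] [AddCommGroup V]
    [Module F V] [AddCommGroup U] [Module F U] {c : V →ₗ[F] V →ₗ[F] U} (hc : c.IsAlt)
    {W₁ W₂ : Submodule F V} (hsup : W₁ ⊔ W₂ = ⊤) (horth : ∀ x ∈ W₁, ∀ y ∈ W₂, c x y = 0)
    {x x' y y' : V} (hx : x ∈ W₁) (hx' : x' ∈ W₁) (hy : y ∈ W₂) (hy' : y' ∈ W₂)
    (h : c x x' = c y y') (hne : c x x' ≠ 0) : ¬ IsCapable.{_, v} (BaerGroup c) := by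
  intro hcap
  have sup_eq_top : comapFst c W₁ ⊔ comapFst c W₂ = ⊤ := eq_top_iff.2 fun ⟨v, u⟩ _ => by
    obtain ⟨x, hx, y, hy, rfl⟩ := Submodule.mem_sup.1 (hsup ▸ Submodule.mem_top : v ∈ W₁ ⊔ W₂)
    have mk_eq_mul : (⟨x + y, u⟩ : BaerGroup c) = ⟨x, u⟩ * ⟨y, 0⟩ := by
      ext <;> simp [horth x hx y hy]
    rw [mk_eq_mul]
    exact Subgroup.mul_mem_sup hx hy
  have commutator_eq_bot : ⁅comapFst c W₁, comapFst c W₂⁆ = ⊥ :=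
    eq_bot_iff.2 <| Subgroup.commutator_le.2 fun g hg k hk => by
      rw [commutator_eq hc, horth _ hg _ hk]
      exact Subgroup.mem_bot.2 rfl
  have := hcap.commutator_eq_one_of_commutator_eq sup_eq_top commutator_eq_bot
    (a := ⟨x, 0⟩) (a' := ⟨x', 0⟩) (b := ⟨y, 0⟩) (b' := ⟨y', 0⟩) hx hx' hy hy'
    (by rw [commutator_eq hc, commutator_eq hc, h])
  rw [commutator_eq hc] at this
  exact hne (congrArg snd this)

section Symplectic

variable {F V : Type*} [Field F] [AddCommGroup V] [Module F V]

/-- The exterior product of two linear functionals, as an alternating bilinear form. -/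
def wedge (f g : V →ₗ[F] F) : V →ₗ[F] V →ₗ[F] F := f.smulRight g - g.smulRight f

@[simp]
theorem wedge_apply (f g : V →ₗ[F] F) (x y : V) : wedge f g x y = f x * g y - g x * f y := rfl

theorem isAlt_wedge (f g : V →ₗ[F] F) : (wedge f g).IsAlt := fun x => by
  rw [wedge_apply, mul_comm, sub_self]

/-- Four vectors forming two orthogonal hyperbolic pairs for `ω`. -/
def IsSymplecticQuadruple (ω : V →ₗ[F] V →ₗ[F] F) (v : Fin 4 → V) : Prop :=
  ∀ i j, ω (v i) (v j) = !![0, 1, 0, 0; -1, 0, 0, 0; 0, 0, 0, 1; 0, 0, -1, 0] i j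

theorem isSymplecticQuadruple_of_isAlt {ω : V →ₗ[F] V →ₗ[F] F} (hω : ω.IsAlt)
    {x₀ x₁ x₂ x₃ : V} (h₀₁ : ω x₀ x₁ = 1) (h₂₃ : ω x₂ x₃ = 1) (h₀₂ : ω x₀ x₂ = 0)
    (h₀₃ : ω x₀ x₃ = 0) (h₁₂ : ω x₁ x₂ = 0) (h₁₃ : ω x₁ x₃ = 0) :
    IsSymplecticQuadruple ω ![x₀, x₁, x₂, x₃] := fun i j => by
  have h₁₀ := hω.neg x₀ x₁
  have h₃₂ := hω.neg x₂ x₃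
  fin_cases i <;> fin_cases j <;>
    simp [*, ← hω.neg x₀ x₂, ← hω.neg x₀ x₃, ← hω.neg x₁ x₂, ← hω.neg x₁ x₃, hω.self_eq_zero,
      ← h₁₀, ← h₃₂]

theorem exists_isSymplecticQuadruple {ω : V →ₗ[F] V →ₗ[F] F} (hω : ω.IsAlt)
    (ne_wedge : ∀ f g, ω ≠ wedge f g) {x₀ x₁ : V} (h₀₁ : ω x₀ x₁ = 1) :
    ∃ x₂ x₃, IsSymplecticQuadruple ω ![x₀, x₁, x₂, x₃] := by
  -- The projection onto the orthogonal complement of the hyperbolic pair.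
  let q (x : V) : V := x - ω x x₁ • x₀ + ω x x₀ • x₁
  have h₁₀ : ω x₁ x₀ = -1 := by rw [← hω.neg, h₀₁]
  have left_q (x) : ω x₀ (q x) = 0 := by
    simp [q, hω.self_eq_zero, h₀₁, ← hω.neg x₀ x]
  have right_q (x) : ω x₁ (q x) = 0 := by
    simp [q, hω.self_eq_zero, h₁₀, ← hω.neg x₁ x]
  obtain ⟨x, y, hxy⟩ : ∃ x y, ω (q x) (q y) ≠ 0 := by
    by_contra! h
    refine ne_wedge (ω.flip x₁) (ω x₀) (LinearMap.ext₂ fun x y => ?_)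
    have apply_q : ω x (q y) = 0 := by
      have eq_self (z) (h₀ : ω x₀ z = 0) (h₁ : ω x₁ z = 0) : ω (q x) z = ω x z := by
        simp [q, h₀, h₁]
      rw [← eq_self (q y) (left_q y) (right_q y), h]
    simp only [q, map_add, map_sub, map_smul, smul_eq_mul] at apply_q
    rw [wedge_apply, LinearMap.flip_apply, LinearMap.flip_apply, ← hω.neg y x₀, ← hω.neg x x₀]
    linear_combination apply_q
  exact ⟨(ω (q x) (q y))⁻¹ • q x, q y, isSymplecticQuadruple_of_isAlt hω h₀₁ (by simp [hxy])
    (by simp [left_q]) (left_q y) (by simp [right_q]) (right_q y)⟩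

theorem exists_isSymplecticQuadruple_of_isotropic {ω : V →ₗ[F] V →ₗ[F] F} (hω : ω.IsAlt)
    {v w y z : V} (hvw : ω v w = 0) (hvz : ω v z = 1) (hwz : ω w z = 0) (hvy : ω v y = 0)
    (hwy : ω w y = 1) : ∃ y', IsSymplecticQuadruple ω ![v, z, w, y'] := by
  refine ⟨y + ω z y • v, isSymplecticQuadruple_of_isAlt hω hvz ?_ hvw ?_ ?_ ?_⟩
  · simp [hwy, ← hω.neg v w, hvw]
  · simp [hvy, hω.self_eq_zero]
  · rw [← hω.neg, hwz, neg_zero]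
  · simp [← hω.neg v z, hvz]

namespace IsSymplecticQuadruple

variable {ω : V →ₗ[F] V →ₗ[F] F} {v : Fin 4 → V}

theorem exists_dual (h : IsSymplecticQuadruple ω v) :
    ∃ f : Fin 4 → V →ₗ[F] F, (∀ i j, f i (v j) = if i = j then 1 else 0) ∧
      ∀ e, (∀ i, ω (v i) e = 0) → ∀ i, f i e = 0 := by
  refine ⟨![-ω (v 1), ω (v 0), -ω (v 3), ω (v 2)], fun i j => ?_, fun e he i => ?_⟩
  · fin_cases i <;> fin_cases j <;> simp [h _ _]
  · fin_cases i <;> simp [he]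

theorem linearIndependent (h : IsSymplecticQuadruple ω v) : LinearIndependent F v := by
  obtain ⟨f, hf, -⟩ := h.exists_dual
  exact .of_pairwise_dual_eq_zero_one v f (fun i j hij => (hf i j).trans (if_neg hij))
    fun i => (hf i i).trans (if_pos rfl)

theorem linearIndependent_append (h : IsSymplecticQuadruple ω v) {e : V} (he0 : e ≠ 0)
    (he : ∀ i, ω (v i) e = 0) : LinearIndependent F ![v 0, v 1, v 2, v 3, e] := by
  have snoc_eq : (Fin.snoc v e : Fin 5 → V) = ![v 0, v 1, v 2, v 3, e] :=
    funext fun i => by fin_cases i <;> rfl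
  refine snoc_eq ▸ h.linearIndependent.finSnoc fun mem_span => he0 ?_
  obtain ⟨f, hf, f_eq_zero⟩ := h.exists_dual
  obtain ⟨a, rfl⟩ := (Submodule.mem_span_range_iff_exists_fun F).1 mem_span
  have a_eq_zero (i) : a i = 0 := by simpa [hf] using f_eq_zero _ he i
  simp [a_eq_zero]

end IsSymplecticQuadruple

/-- A basis of a five-dimensional space adapted to a bilinear form: the form is
`x₀ ∧ x₁ + x₂ ∧ x₃` in the dual coordinates, and the last basis vector spans its radical. -/
def IsSymplecticBasis (ω : V →ₗ[F] V →ₗ[F] F) (b : Basis (Fin 5) F V) : Prop :=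
  ω = wedge (b.coord 0) (b.coord 1) + wedge (b.coord 2) (b.coord 3)

theorem IsSymplecticQuadruple.exists_basis {ω : V →ₗ[F] V →ₗ[F] F} {v : Fin 4 → V}
    (h : IsSymplecticQuadruple ω v) (hω : ω.IsAlt) (hV : finrank F V = 5) {e : V} (he0 : e ≠ 0)
    (he : ∀ i, ω (v i) e = 0) :
    ∃ b : Basis (Fin 5) F V, ⇑b = ![v 0, v 1, v 2, v 3, e] ∧ IsSymplecticBasis ω b := by
  let b := basisOfLinearIndependentOfCardEqFinrank (h.linearIndependent_append he0 he)
    (by simp [hV])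
  have coe_b : ⇑b = ![v 0, v 1, v 2, v 3, e] := coe_basisOfLinearIndependentOfCardEqFinrank _ _
  have he' (i) : ω e (v i) = 0 := hω.eq_iff.1 (he i)
  refine ⟨b, coe_b, b.ext fun i => b.ext fun j => ?_⟩
  simp only [LinearMap.add_apply, wedge_apply, Basis.coord_apply, Basis.repr_self]
  rw [coe_b]
  fin_cases i <;> fin_cases j <;> simp [h _ _, he, he', hω.self_eq_zero]

namespace IsSymplecticBasis

variable {ω : V →ₗ[F] V →ₗ[F] F} {b : Basis (Fin 5) F V}

theorem apply_zero (hb : IsSymplecticBasis ω b) : ω (b 0) = b.coord 1 := by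
  rw [hb]
  ext
  simp

theorem apply_one (hb : IsSymplecticBasis ω b) : ω (b 1) = -b.coord 0 := by
  rw [hb]
  ext
  simp

theorem apply_two (hb : IsSymplecticBasis ω b) : ω (b 2) = b.coord 3 := by
  rw [hb]
  ext
  simp

theorem apply_four (hb : IsSymplecticBasis ω b) (x : V) : ω x (b 4) = 0 := by
  rw [hb]
  simp

theorem exists_apply_eq (hb : IsSymplecticBasis ω b) {s : V →ₗ[F] F} (hs : s (b 4) = 0) :
    ∃ v, ω v = s := by
  refine ⟨s (b 1) • b 0 - s (b 0) • b 1 + s (b 3) • b 2 - s (b 2) • b 3, b.ext fun i => ?_⟩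
  rw [hb]
  fin_cases i <;> simp [hs]

end IsSymplecticBasis

end Symplectic

section Jacobi

variable {F V U : Type*} [Field F] [AddCommGroup V] [Module F V] [AddCommGroup U] [Module F U]
  {c : V →ₗ[F] V →ₗ[F] U} {β : U →ₗ[F] V →ₗ[F] F}

theorem jac_smulRight (μ : U →ₗ[F] F) (g : V →ₗ[F] F) (x y z : V) :
    jac c (μ.smulRight g) x y z = μ (c x y) * g z + μ (c y z) * g x + μ (c z x) * g y := rfl

theorem jac_add (β β' : U →ₗ[F] V →ₗ[F] F) (x y z : V) :
    jac c (β + β') x y z = jac c β x y z + jac c β' x y z := by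
  simp only [jac, LinearMap.add_apply]
  ring

theorem jac_sub (β β' : U →ₗ[F] V →ₗ[F] F) (x y z : V) :
    jac c (β - β') x y z = jac c β x y z - jac c β' x y z := by
  simp only [jac, LinearMap.sub_apply]
  ring

theorem jac_rotate (x y z : V) : jac c β x y z = jac c β y z x := by
  simp only [jac]
  ring

theorem jac_swap (hc : c.IsAlt) (x y z : V) : jac c β y x z = -jac c β x y z := by
  simp only [jac, ← hc.neg x y, ← hc.neg z x, ← hc.neg y z, map_neg, LinearMap.neg_apply]
  ring

theorem jac_self (hc : c.IsAlt) (x z : V) : jac c β x x z = 0 := by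
  simp [jac, hc.self_eq_zero, ← hc.neg z x]

theorem isJacobi_of_basis {ι : Type*} [LinearOrder ι] (hc : c.IsAlt) (b : Basis ι F V)
    (h : ∀ i j k, i < j → j < k → jac c β (b i) (b j) (b k) = 0) : IsJacobi c β := by
  have jac_basis (i j k) : jac c β (b i) (b j) (b k) = 0 := by
    rcases lt_trichotomy i j with hij | hij | hij <;>
    rcases lt_trichotomy j k with hjk | hjk | hjk <;>
    rcases lt_trichotomy i k with hik | hik | hik <;>
    grind [jac_rotate, jac_swap, jac_self]
  have extend (y z : V) (h : ∀ i, jac c β (b i) y z = 0) (x : V) : jac c β x y z = 0 := by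
    have : (β.flip z).comp (c.flip y) + β (c y z) + (β.flip y).comp (c z) = 0 :=
      b.ext fun i => by simpa [jac] using h i
    simpa [jac] using LinearMap.congr_fun this x
  intro x y z
  refine extend y z (fun i => ?_) x
  rw [jac_rotate]
  refine extend z (b i) (fun j => ?_) y
  rw [jac_rotate]
  exact extend (b i) (b j) (fun k => (jac_rotate _ _ _).trans (jac_basis i j k)) z

-- The trivectors without the last index are the multiples `ω ∧ f` of `ω = x₀ ∧ x₁ + x₂ ∧ x₃`.
theorem IsSymplecticBasis.exists_isJacobi_sub {b : Basis (Fin 5) F V} {l : U →ₗ[F] F}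
    (hb : IsSymplecticBasis (c.compr₂ l) b) (hc : c.IsAlt) {t : F}
    (h : ∀ x y, jac c β x y (b 4) = t * l (c x y)) :
    ∃ f : V →ₗ[F] F, f (b 4) = t ∧ IsJacobi c (β - l.smulRight f) := by
  have l_basis (i j) : l (c (b i) (b j)) =
      (wedge (b.coord 0) (b.coord 1) + wedge (b.coord 2) (b.coord 3)) (b i) (b j) :=
    LinearMap.congr_fun₂ hb _ _
  let τ (i j k : Fin 5) : F := jac c β (b i) (b j) (b k)
  let f : V →ₗ[F] F := b.constr F ![τ 0 2 3, τ 1 2 3, τ 0 1 2, τ 0 1 3, t]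
  have f_basis (i) : f (b i) = ![τ 0 2 3, τ 1 2 3, τ 0 1 2, τ 0 1 3, t] i := b.constr_basis F _ i
  refine ⟨f, f_basis 4, isJacobi_of_basis hc b fun i j k hij hjk => ?_⟩
  rw [jac_sub, jac_smulRight]
  have sorted_triples : k = 4 ∨ i = 0 ∧ j = 1 ∧ k = 2 ∨ i = 0 ∧ j = 1 ∧ k = 3 ∨
      i = 0 ∧ j = 2 ∧ k = 3 ∨ i = 1 ∧ j = 2 ∧ k = 3 := by
    omega
  obtain rfl | hijk := sorted_triples
  · simp [h, l_basis, f_basis, mul_comm t]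
  · obtain ⟨rfl, rfl, rfl⟩ | ⟨rfl, rfl, rfl⟩ | ⟨rfl, rfl, rfl⟩ | ⟨rfl, rfl, rfl⟩ := hijk <;>
      simp [l_basis, f_basis, τ]

end Jacobi

section Epicentral

variable {F V U : Type*} [Field F] [AddCommGroup V] [Module F V] [AddCommGroup U] [Module F U]
  {c : V →ₗ[F] V →ₗ[F] U} {u₀ : U}

theorem exists_apply_eq_zero_of_forall_ne_smul {f g : V →ₗ[F] F} (h : ∀ a : F, g ≠ a • f) :
    ∃ y, f y = 0 ∧ g y = 1 := by
  obtain ⟨y, hfy, hgy⟩ : ∃ y, f y = 0 ∧ g y ≠ 0 := by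
    by_contra! ker_le
    have mem_span := mem_span_of_iInf_ker_le_ker (ι := Unit) (L := fun _ => f) (K := g)
      fun y hy => ker_le y (by simpa using hy)
    obtain ⟨a, ha⟩ := Submodule.mem_span_singleton.1 (by simpa using mem_span)
    exact h a ha.symm
  exact ⟨(g y)⁻¹ • y, by simp [hfy], by simp [hgy]⟩

theorem dual_ext_of_map₂_eq_top (hs : Submodule.map₂ c ⊤ ⊤ = ⊤) {μ ν : U →ₗ[F] F}
    (h : c.compr₂ μ = c.compr₂ ν) : μ = ν := by
  have le_eqLocus : Submodule.map₂ c ⊤ ⊤ ≤ LinearMap.eqLocus μ ν :=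
    Submodule.map₂_le.2 fun x _ y _ => LinearMap.congr_fun₂ h x y
  exact LinearMap.ext fun u => le_eqLocus (hs ▸ Submodule.mem_top)

namespace IsEpicentral

variable {l : U →ₗ[F] F}

theorem eq_zero_of_isJacobi_smulRight (hu : IsEpicentral c u₀) (hl : l u₀ = 1) {f : V →ₗ[F] F}
    (hf : IsJacobi c (l.smulRight f)) : f = 0 := by
  simpa [hl] using hu _ hf

theorem compr₂_ne_wedge [Nontrivial V] (hu : IsEpicentral c u₀) (hl : l u₀ = 1)
    (f g : V →ₗ[F] F) : c.compr₂ l ≠ wedge f g := fun h => by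
  have l_apply (x y) : l (c x y) = f x * g y - g x * f y := LinearMap.congr_fun₂ h x y
  obtain rfl : f = 0 := hu.eq_zero_of_isJacobi_smulRight hl fun x y z => by
    simp only [jac_smulRight, l_apply]
    ring
  obtain ⟨v, hv⟩ := exists_ne (0 : V)
  obtain ⟨s, hs⟩ := Module.Projective.exists_dual_eq_one F hv
  obtain rfl : s = 0 := hu.eq_zero_of_isJacobi_smulRight hl fun x y z => by
    simp [jac_smulRight, l_apply]
  simp at hs

theorem exists_isSymplecticQuadruple [Nontrivial V] (hc : c.IsAlt) (hu : IsEpicentral c u₀)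
    (hl : l u₀ = 1) {x₀ x₁ : V} (h₀₁ : l (c x₀ x₁) = 1) :
    ∃ x₂ x₃, IsSymplecticQuadruple (c.compr₂ l) ![x₀, x₁, x₂, x₃] :=
  _root_.exists_isSymplecticQuadruple (fun x => by simp [hc.self_eq_zero])
    (hu.compr₂_ne_wedge hl) h₀₁

theorem exists_isSymplecticBasis (hc : c.IsAlt) (hu : IsEpicentral c u₀) (hl : l u₀ = 1)
    (hV : finrank F V = 5) : ∃ b : Basis (Fin 5) F V, IsSymplecticBasis (c.compr₂ l) b := by
  have : Nontrivial V := nontrivial_of_finrank_pos (R := F) (by lia)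
  have : FiniteDimensional F V := .of_finrank_pos (by lia)
  obtain ⟨x, y, hxy⟩ : ∃ x y, l (c x y) ≠ 0 := by
    by_contra! h
    exact hu.compr₂_ne_wedge hl 0 0 (LinearMap.ext₂ fun x y => by simp [h])
  obtain ⟨x₂, x₃, quad⟩ := hu.exists_isSymplecticQuadruple (x₀ := (l (c x y))⁻¹ • x) (x₁ := y) hc hl
    (by simp [hxy])
  set v := ![(l (c x y))⁻¹ • x, y, x₂, x₃]
  obtain ⟨e, he, he0⟩ := (Submodule.ne_bot_iff _).1 <|
    LinearMap.ker_ne_bot_of_finrank_lt (f := LinearMap.pi fun i => c.compr₂ l (v i)) (by simp [hV])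
  obtain ⟨b, -, hb⟩ := quad.exists_basis (fun x => by simp [hc.self_eq_zero]) hV he0 (congrFun he)
  exact ⟨b, hb⟩

end IsEpicentral

/-- The data of a nonzero epicentral vector `u₀` of a spanning alternating map in dimension five:
a functional `l` with `l u₀ = 1` and a symplectic basis for the form it induces. -/
structure IsEpicentralFrame (c : V →ₗ[F] V →ₗ[F] U) (u₀ : U) (l : U →ₗ[F] F)
    (b : Basis (Fin 5) F V) : Prop where
  isAlt : c.IsAlt
  map₂_eq_top : Submodule.map₂ c ⊤ ⊤ = ⊤
  isEpicentral : IsEpicentral c u₀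
  apply_eq_one : l u₀ = 1
  isSymplecticBasis : IsSymplecticBasis (c.compr₂ l) b

namespace IsEpicentralFrame

variable {l μ ν : U →ₗ[F] F} {b : Basis (Fin 5) F V}

theorem isJacobi (hb : IsEpicentralFrame c u₀ l b) {β : U →ₗ[F] V →ₗ[F] F} (hβ : β u₀ = 0) {t : F}
    (h : ∀ x y, jac c β x y (b 4) = t * l (c x y)) : t = 0 ∧ IsJacobi c β := by
  obtain ⟨f, rfl, hf⟩ := hb.isSymplecticBasis.exists_isJacobi_sub hb.isAlt h
  obtain rfl : f = 0 := by simpa [hβ, hb.apply_eq_one] using hb.isEpicentral _ hf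
  exact ⟨rfl, fun x y z => by
    simpa only [jac_sub, jac_smulRight, LinearMap.zero_apply, mul_zero, add_zero, sub_zero]
      using hf x y z⟩

theorem exists_extending (hb : IsEpicentralFrame c u₀ l b) {x₀ x₁ : V} (h₀₁ : l (c x₀ x₁) = 1) :
    ∃ b', IsEpicentralFrame c u₀ l b' ∧ b' 0 = x₀ ∧ b' 1 = x₁ ∧ b' 4 = b 4 := by
  have : Nontrivial V := ⟨b 4, 0, b.ne_zero 4⟩
  obtain ⟨x₂, x₃, quad⟩ := hb.isEpicentral.exists_isSymplecticQuadruple hb.isAlt hb.apply_eq_one h₀₁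
  obtain ⟨b', coe_b', hb'⟩ := quad.exists_basis (fun x => by simp [hb.isAlt.self_eq_zero])
    (by simp [finrank_eq_card_basis b]) (b.ne_zero 4) fun i => hb.isSymplecticBasis.apply_four _
  exact ⟨b', { hb with isSymplecticBasis := hb' }, by simp [coe_b'], by simp [coe_b'],
    by simp [coe_b']⟩

theorem eq_zero_of_comp_eq_zero (hb : IsEpicentralFrame c u₀ l b) (hμ : μ u₀ = 0)
    (h : μ ∘ₗ c (b 4) = 0) : μ = 0 := by
  have left_eq_zero (x) : μ (c (b 4) x) = 0 := LinearMap.congr_fun h x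
  have right_eq_zero (x) : μ (c x (b 4)) = 0 := by simp [← hb.isAlt.neg (b 4) x, left_eq_zero]
  refine dual_ext_of_map₂_eq_top hb.map₂_eq_top (b.ext fun i => b.ext fun j => ?_)
  obtain ⟨k, hki, hkj, hk4⟩ : ∃ k : Fin 5, k ≠ i ∧ k ≠ j ∧ k ≠ 4 := by
    revert i j
    decide
  have isJacobi := (hb.isJacobi (β := μ.smulRight (b.coord k)) (t := 0) (by simp [hμ])
    fun x y => by simp [jac_smulRight, left_eq_zero, right_eq_zero, hk4]).2 (b i) (b j) (b k)
  simpa [jac_smulRight, hki, hkj] using isJacobi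

theorem isJacobi_smulRight_comp_add (hb : IsEpicentralFrame c u₀ l b) (hμ : μ u₀ = 0)
    (hν : ν u₀ = 0) :
    IsJacobi c (μ.smulRight (ν ∘ₗ c (b 4)) + ν.smulRight (μ ∘ₗ c (b 4))) := by
  refine (hb.isJacobi (t := 0) (by simp [hμ, hν]) fun x y => ?_).2
  simp only [jac_add, jac_smulRight, LinearMap.comp_apply, ← hb.isAlt.neg (b 4) y,
    hb.isAlt.self_eq_zero, map_neg, map_zero]
  ring

theorem isJacobi_smulRight_comp (hb : IsEpicentralFrame c u₀ l b) (hμ : μ u₀ = 0) :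
    IsJacobi c (μ.smulRight (μ ∘ₗ c (b 4))) := by
  refine (hb.isJacobi (t := 0) (by simp [hμ]) fun x y => ?_).2
  simp only [jac_smulRight, LinearMap.comp_apply, ← hb.isAlt.neg (b 4) y,
    hb.isAlt.self_eq_zero, map_neg, map_zero]
  ring

theorem compr₂_eq_wedge (hb : IsEpicentralFrame c u₀ l b) (hμ : μ u₀ = 0) {z : V}
    (hz : μ (c (b 4) z) = 1) : c.compr₂ μ = wedge (μ ∘ₗ c (b 4)) (μ ∘ₗ c z) := by
  refine LinearMap.ext₂ fun x y => ?_
  have jacobi := hb.isJacobi_smulRight_comp hμ x y z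
  simp only [jac_smulRight, LinearMap.comp_apply, hz, ← hb.isAlt.neg z y, map_neg] at jacobi
  simp only [LinearMap.compr₂_apply, wedge_apply, LinearMap.comp_apply]
  linear_combination jacobi

theorem compr₂_eq_wedge_pair (hb : IsEpicentralFrame c u₀ l b) (hμ : μ u₀ = 0) (hν : ν u₀ = 0)
    {z z' : V} (hμz : μ (c (b 4) z) = 1) (hνz : ν (c (b 4) z) = 0)
    (hνz' : ν (c (b 4) z') = 1) :
    ∃ g : V →ₗ[F] F, g (b 4) = -1 ∧ c.compr₂ μ = wedge (μ ∘ₗ c (b 4)) g ∧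
      c.compr₂ ν = wedge (ν ∘ₗ c (b 4)) g := by
  have μ_apply (x y) := LinearMap.congr_fun₂ (hb.compr₂_eq_wedge hμ hμz) x y
  have ν_apply (x y) := LinearMap.congr_fun₂ (hb.compr₂_eq_wedge hν hνz') x y
  simp only [LinearMap.compr₂_apply, wedge_apply, LinearMap.comp_apply] at μ_apply ν_apply
  refine ⟨μ ∘ₗ c z - ν (c z z') • μ ∘ₗ c (b 4), ?_, LinearMap.ext₂ fun x y => ?_,
    LinearMap.ext₂ fun x y => ?_⟩
  · simp [← hb.isAlt.neg (b 4) z, hμz, hb.isAlt.self_eq_zero]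
  · simp only [LinearMap.compr₂_apply, μ_apply x y, wedge_apply, LinearMap.comp_apply,
      LinearMap.sub_apply, LinearMap.smul_apply, smul_eq_mul]
    ring
  · have ν_left (w) : ν (c z w) = ν (c z z') * ν (c (b 4) w) := by
      rw [ν_apply z w, hνz, ← hb.isAlt.neg z z', map_neg]
      ring
    have jacobi := hb.isJacobi_smulRight_comp_add hμ hν x y z
    simp only [jac_add, jac_smulRight, LinearMap.comp_apply, hμz, hνz, ← hb.isAlt.neg z y,
      ν_left x, ν_left y, map_neg] at jacobi
    simp only [LinearMap.compr₂_apply, wedge_apply, LinearMap.comp_apply, LinearMap.sub_apply,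
      LinearMap.smul_apply, smul_eq_mul]
    linear_combination jacobi

theorem exists_contraction_eq (hb : IsEpicentralFrame c u₀ l b) (μ : U →ₗ[F] F) :
    ∃ v, c.compr₂ l v = μ ∘ₗ c (b 4) :=
  hb.isSymplecticBasis.exists_apply_eq (by simp [hb.isAlt.self_eq_zero])

theorem comp_ne_smul (hb : IsEpicentralFrame c u₀ l b) (hμ : μ u₀ = 0) (hν : ν u₀ = 0)
    (h : ∀ a : F, ν ≠ a • μ) (a : F) : ν ∘ₗ c (b 4) ≠ a • μ ∘ₗ c (b 4) := fun comp_eq =>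
  h a <| sub_eq_zero.1 <| hb.eq_zero_of_comp_eq_zero (by simp [hμ, hν]) <| by
    rw [LinearMap.sub_comp, comp_eq, LinearMap.smul_comp, sub_self]

theorem not_isSymplecticQuadruple_of_isotropic (hb : IsEpicentralFrame c u₀ l b) (hμ : μ u₀ = 0)
    (hν : ν u₀ = 0) {v w y z : V} (hv : c.compr₂ l v = μ ∘ₗ c (b 4))
    (hw : c.compr₂ l w = ν ∘ₗ c (b 4)) : ¬ IsSymplecticQuadruple (c.compr₂ l) ![v, z, w, y] := by
  intro quad
  obtain ⟨b', coe_b', hb'⟩ := quad.exists_basis (fun x => by simp [hb.isAlt.self_eq_zero])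
    (by simp [finrank_eq_card_basis b]) (b.ne_zero 4) fun i => hb.isSymplecticBasis.apply_four _
  have b'_four : b' 4 = b 4 := by simp [coe_b']
  have l_apply (x y) : l (c x y) =
      (wedge (b'.coord 0) (b'.coord 1) + wedge (b'.coord 2) (b'.coord 3)) x y :=
    LinearMap.congr_fun₂ hb' x y
  have μ_apply (x) : μ (c (b' 4) x) = b'.coord 1 x := by
    rw [← hb'.apply_zero, show b' 0 = v by simp [coe_b'], hv, b'_four, LinearMap.comp_apply]
  have ν_apply (x) : ν (c (b' 4) x) = b'.coord 3 x := by
    rw [← hb'.apply_two, show b' 2 = w by simp [coe_b'], hw, b'_four, LinearMap.comp_apply]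
  let β := μ.smulRight (-b'.coord 0) + ν.smulRight (-b'.coord 2)
  refine one_ne_zero (IsEpicentralFrame.isJacobi { hb with isSymplecticBasis := hb' }
    (β := β) (t := 1) (by simp [β, hμ, hν]) fun x y => ?_).1
  have coord_four {i : Fin 5} (hi : i ≠ 4) : b'.coord i (b' 4) = 0 := by simp [hi.symm]
  simp only [β, jac_add, jac_smulRight, LinearMap.neg_apply, coord_four (i := 0) (by decide),
    coord_four (i := 2) (by decide), ← hb.isAlt.neg (b' 4) y, map_neg, μ_apply, ν_apply, l_apply,
    LinearMap.add_apply, wedge_apply]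
  ring

theorem exists_eq_smul_of_isotropic (hb : IsEpicentralFrame c u₀ l b) (hμ : μ u₀ = 0)
    (hν : ν u₀ = 0) (hμ0 : μ ≠ 0) {v w : V} (hv : c.compr₂ l v = μ ∘ₗ c (b 4))
    (hw : c.compr₂ l w = ν ∘ₗ c (b 4)) (hvw : l (c v w) = 0) : ∃ a : F, ν = a • μ := by
  by_contra! not_smul
  have not_smul' (a : F) : μ ≠ a • ν := by
    rintro rfl
    exact not_smul a⁻¹ (inv_smul_smul₀ (fun ha => hμ0 (by simp [ha])) ν).symm
  obtain ⟨z, hνz, hμz⟩ :=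
    exists_apply_eq_zero_of_forall_ne_smul (hb.comp_ne_smul hν hμ not_smul')
  obtain ⟨y, hμy, hνy⟩ :=
    exists_apply_eq_zero_of_forall_ne_smul (hb.comp_ne_smul hμ hν not_smul)
  rw [← hv] at hμz hμy
  rw [← hw] at hνz hνy
  obtain ⟨y', quad⟩ := exists_isSymplecticQuadruple_of_isotropic
    (fun x => by simp [hb.isAlt.self_eq_zero]) hvw hμz hνz hμy hνy
  exact hb.not_isSymplecticQuadruple_of_isotropic hμ hν hv hw quad

end IsEpicentralFrame

end Epicentral

section FormEquiv

variable {F V U V' U' : Type*} [Field F] [AddCommGroup V] [Module F V] [AddCommGroup U]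
  [Module F U] [AddCommGroup V'] [Module F V'] [AddCommGroup U'] [Module F U']
  {c : V →ₗ[F] V →ₗ[F] U} {c' : V' →ₗ[F] V' →ₗ[F] U'}

/-- Bilinear maps that agree up to linear changes of variables in the source and in the target. -/
def FormEquiv (c : V →ₗ[F] V →ₗ[F] U) (c' : V' →ₗ[F] V' →ₗ[F] U') : Prop :=
  ∃ (P : V ≃ₗ[F] V') (Q : U ≃ₗ[F] U'), ∀ x y, Q (c x y) = c' (P x) (P y)

theorem FormEquiv.of_injective (hs : Submodule.map₂ c' ⊤ ⊤ = ⊤) (P : V ≃ₗ[F] V')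
    {Q : U →ₗ[F] U'} (hQ : Function.Injective Q) (h : ∀ x y, Q (c x y) = c' (P x) (P y)) :
    FormEquiv c c' := by
  refine ⟨P, .ofBijective Q ⟨hQ, LinearMap.range_eq_top.1 (top_unique ?_)⟩, h⟩
  rw [← hs, Submodule.map₂_le]
  exact fun x _ y _ => ⟨c (P.symm x) (P.symm y), by simp [h]⟩

theorem FormEquiv.nonempty_mulEquiv (h : FormEquiv c c') :
    Nonempty (BaerGroup c ≃* BaerGroup c') :=
  let ⟨P, Q, hPQ⟩ := h
  ⟨BaerGroup.congr P Q hPQ⟩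

end FormEquiv

section Models

variable (F : Type*) [Field F]

/-- The symplectic form on the plane. -/
def planeForm : (Fin 2 → F) →ₗ[F] (Fin 2 → F) →ₗ[F] F :=
  wedge (LinearMap.proj 0) (LinearMap.proj 1)

variable {F} {V W U ι : Type*} [AddCommGroup V] [Module F V] [AddCommGroup W] [Module F W]
  [AddCommGroup U] [Module F U]

/-- The orthogonal sum of a bilinear map and of the symplectic plane, whose form takes its values
in the line of `u`. -/
def planeSum (c : W →ₗ[F] W →ₗ[F] U) (u : U) :
    ((Fin 2 → F) × W) →ₗ[F] ((Fin 2 → F) × W) →ₗ[F] U :=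
  ((planeForm F).compr₂ (LinearMap.toSpanSingleton F U u)).compl₁₂ (LinearMap.fst F _ W)
    (LinearMap.fst F _ W) + c.compl₁₂ (LinearMap.snd F _ W) (LinearMap.snd F _ W)

@[simp]
theorem planeSum_apply (c : W →ₗ[F] W →ₗ[F] U) (u : U) (x y : (Fin 2 → F) × W) :
    planeSum c u x y = planeForm F x.1 y.1 • u + c x.2 y.2 := rfl

theorem isAlt_planeSum {c : W →ₗ[F] W →ₗ[F] U} (hc : c.IsAlt) (u : U) : (planeSum c u).IsAlt :=
  fun x => by rw [planeSum_apply, planeForm, isAlt_wedge, hc, zero_smul, zero_add]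

theorem map₂_planeSum_eq_top {c : W →ₗ[F] W →ₗ[F] U} (hs : Submodule.map₂ c ⊤ ⊤ = ⊤) (u : U) :
    Submodule.map₂ (planeSum c u) ⊤ ⊤ = ⊤ := by
  refine top_unique (hs.ge.trans (Submodule.map₂_le.2 fun x _ y _ => ?_))
  rw [show c x y = planeSum c u (0, x) (0, y) by simp]
  exact Submodule.apply_mem_map₂ _ trivial trivial

/-- The bilinear map with the given coordinate forms. -/
def formMap (ω : ι → V →ₗ[F] V →ₗ[F] F) : V →ₗ[F] V →ₗ[F] (ι → F) :=
  LinearMap.mk₂ F (fun x y i => ω i x y) (fun _ _ _ => by ext; simp) (fun _ _ _ => by ext; simp)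
    (fun _ _ _ => by ext; simp) (fun _ _ _ => by ext; simp)

@[simp]
theorem formMap_apply (ω : ι → V →ₗ[F] V →ₗ[F] F) (x y : V) (i : ι) :
    formMap ω x y i = ω i x y := rfl

theorem isAlt_formMap {ω : ι → V →ₗ[F] V →ₗ[F] F} (h : ∀ i, (ω i).IsAlt) : (formMap ω).IsAlt :=
  fun x => funext fun i => h i x

theorem map₂_eq_top_of_basis {c : V →ₗ[F] V →ₗ[F] U} (b : Basis ι F U)
    (h : ∀ i, ∃ x y, c x y = b i) : Submodule.map₂ c ⊤ ⊤ = ⊤ := by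
  rw [← top_le_iff, ← b.span_eq, Submodule.span_le, Set.range_subset_iff]
  intro i
  obtain ⟨x, y, hxy⟩ := h i
  exact hxy ▸ Submodule.apply_mem_map₂ _ trivial trivial

variable (F)

theorem map₂_wedge_eq_top {f g : V →ₗ[F] F} {x y : V} (h : wedge f g x y = 1) :
    Submodule.map₂ (wedge f g) ⊤ ⊤ = ⊤ :=
  map₂_eq_top_of_basis (Basis.singleton Unit F) fun _ => ⟨x, y, by simpa using h⟩

/-- The form `x₀ ∧ x₁` on a three-dimensional space. -/
def spaceForm : (Fin 3 → F) →ₗ[F] (Fin 3 → F) →ₗ[F] F :=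
  wedge (LinearMap.proj 0) (LinearMap.proj 1)

/-- The forms `x₀ ∧ x₁` and `x₀ ∧ x₂` on a three-dimensional space. -/
def spaceFormPair : (Fin 3 → F) →ₗ[F] (Fin 3 → F) →ₗ[F] (Fin 2 → F) :=
  formMap ![wedge (LinearMap.proj 0) (LinearMap.proj 1),
    wedge (LinearMap.proj 0) (LinearMap.proj 2)]

/-- The forms `x₀ ∧ x₁`, `x₀ ∧ x₂` and `x₁ ∧ x₂` on a three-dimensional space. -/
def spaceFormTriple : (Fin 3 → F) →ₗ[F] (Fin 3 → F) →ₗ[F] (Fin 3 → F) :=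
  formMap ![wedge (LinearMap.proj 0) (LinearMap.proj 1),
    wedge (LinearMap.proj 0) (LinearMap.proj 2), wedge (LinearMap.proj 1) (LinearMap.proj 2)]

theorem isAlt_planeForm : (planeForm F).IsAlt := isAlt_wedge _ _

theorem isAlt_spaceForm : (spaceForm F).IsAlt := isAlt_wedge _ _

theorem isAlt_spaceFormPair : (spaceFormPair F).IsAlt :=
  isAlt_formMap fun i => by fin_cases i <;> exact isAlt_wedge _ _

theorem isAlt_spaceFormTriple : (spaceFormTriple F).IsAlt :=
  isAlt_formMap fun i => by fin_cases i <;> exact isAlt_wedge _ _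

theorem map₂_planeForm_eq_top : Submodule.map₂ (planeForm F) ⊤ ⊤ = ⊤ :=
  map₂_wedge_eq_top F (x := Pi.single 0 1) (y := Pi.single 1 1) (by simp)

theorem map₂_spaceForm_eq_top : Submodule.map₂ (spaceForm F) ⊤ ⊤ = ⊤ :=
  map₂_wedge_eq_top F (x := Pi.single 0 1) (y := Pi.single 1 1) (by simp)

theorem map₂_spaceFormPair_eq_top : Submodule.map₂ (spaceFormPair F) ⊤ ⊤ = ⊤ := by
  refine map₂_eq_top_of_basis (Pi.basisFun F (Fin 2)) fun i =>
    ⟨Pi.single 0 1, Pi.single (![1, 2] i) 1, funext fun j => ?_⟩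
  fin_cases i <;> fin_cases j <;> simp [spaceFormPair]

theorem map₂_spaceFormTriple_eq_top : Submodule.map₂ (spaceFormTriple F) ⊤ ⊤ = ⊤ := by
  refine map₂_eq_top_of_basis (Pi.basisFun F (Fin 3)) fun i =>
    ⟨Pi.single (![0, 0, 1] i) 1, Pi.single (![1, 2, 2] i) 1, funext fun j => ?_⟩
  fin_cases i <;> fin_cases j <;> simp [spaceFormTriple]

/-- The commutator map of the extra-special group of order `p⁵` and exponent `p`. -/
def extraSpecialForm : ((Fin 2 → F) × (Fin 2 → F)) →ₗ[F] ((Fin 2 → F) × (Fin 2 → F)) →ₗ[F] F :=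
  planeSum (planeForm F) 1

theorem isAlt_extraSpecialForm : (extraSpecialForm F).IsAlt :=
  isAlt_planeSum (isAlt_planeForm F) 1

theorem map₂_extraSpecialForm_eq_top : Submodule.map₂ (extraSpecialForm F) ⊤ ⊤ = ⊤ :=
  map₂_planeSum_eq_top (map₂_planeForm_eq_top F) 1

/-- The commutator map of the group of type (i). -/
def typeIForm : ((Fin 2 → F) × (Fin 3 → F)) →ₗ[F] ((Fin 2 → F) × (Fin 3 → F)) →ₗ[F] F :=
  planeSum (spaceForm F) 1

/-- The commutator map of the group of type (ii). -/
def typeIIForm :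
    ((Fin 2 → F) × (Fin 3 → F)) →ₗ[F] ((Fin 2 → F) × (Fin 3 → F)) →ₗ[F] (Fin 3 → F) :=
  planeSum (spaceFormTriple F) (Pi.single 0 1)

/-- The commutator map of the group of type (iii). -/
def typeIIIForm :
    ((Fin 2 → F) × (Fin 3 → F)) →ₗ[F] ((Fin 2 → F) × (Fin 3 → F)) →ₗ[F] (Fin 2 → F) :=
  planeSum (spaceFormPair F) (Pi.single 0 1)

end Models

section Classification

variable {F V U : Type*} [Field F] [AddCommGroup V] [Module F V] [AddCommGroup U] [Module F U]
  {c : V →ₗ[F] V →ₗ[F] U} {u₀ : U}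

theorem exists_adapted_coordinates (b : Basis (Fin 5) F V) {g : V →ₗ[F] F} (hg : g (b 4) = -1) :
    ∃ P : V ≃ₗ[F] (Fin 2 → F) × (Fin 3 → F), ∀ x,
      P x = (![b.coord 2 x, b.coord 3 x], ![-b.coord 1 x, b.coord 0 x, -g x]) := by
  let P : V →ₗ[F] (Fin 2 → F) × (Fin 3 → F) := (LinearMap.pi ![b.coord 2, b.coord 3]).prod
    (LinearMap.pi ![-b.coord 1, b.coord 0, -g])
  have P_apply (x) :
      P x = (![b.coord 2 x, b.coord 3 x], ![-b.coord 1 x, b.coord 0 x, -g x]) := by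
    ext i <;> fin_cases i <;> simp [P]
  have injective_P : Function.Injective P := by
    rw [← LinearMap.ker_eq_bot, LinearMap.ker_eq_bot']
    intro x hx
    obtain ⟨⟨h₂, h₃⟩, h₁, h₀, hgx⟩ : (b.repr x 2 = 0 ∧ b.repr x 3 = 0) ∧
        b.repr x 1 = 0 ∧ b.repr x 0 = 0 ∧ g x = 0 := by
      simpa [P_apply, Prod.ext_iff, funext_iff, Fin.forall_fin_succ] using hx
    have h₄ : b.repr x 4 = 0 := by
      rw [← b.sum_repr x, Fin.sum_univ_five] at hgx
      simpa only [map_add, map_smul, h₀, h₁, h₂, h₃, hg, zero_smul, zero_add, smul_eq_mul,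
        mul_neg, mul_one, neg_eq_zero] using hgx
    exact b.ext_elem fun i => by fin_cases i <;> simpa
  have : FiniteDimensional F V := b.finiteDimensional_of_finite
  exact ⟨LinearMap.linearEquivOfInjective P injective_P (by simp [finrank_eq_card_basis b]),
    P_apply⟩

namespace IsEpicentralFrame

variable {l μ ν : U →ₗ[F] F} {b : Basis (Fin 5) F V}

theorem eq_zero_of_apply_eq_zero (hb : IsEpicentralFrame c u₀ l b) {u : U} (hl : l u = 0)
    (h : ∀ μ : U →ₗ[F] F, μ u₀ = 0 → μ u = 0) : u = 0 :=
  (Module.forall_dual_apply_eq_zero_iff F u).1 fun φ => by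
    simpa [hl] using h (φ - φ u₀ • l) (by simp [hb.apply_eq_one])

theorem formEquiv_typeIForm (hb : IsEpicentralFrame c u₀ l b)
    (h : ∀ μ : U →ₗ[F] F, μ u₀ = 0 → μ = 0) : FormEquiv c (typeIForm F) := by
  obtain ⟨P, hP⟩ := exists_adapted_coordinates b (g := -b.coord 4) (by simp)
  have injective_l : Function.Injective l := by
    refine (injective_iff_map_eq_zero l).2 fun u hu => hb.eq_zero_of_apply_eq_zero hu fun μ hμ => ?_
    rw [h μ hμ, LinearMap.zero_apply]
  refine .of_injective (map₂_planeSum_eq_top (map₂_spaceForm_eq_top F) 1) P injective_l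
    fun x y => ?_
  rw [← LinearMap.compr₂_apply, hb.isSymplecticBasis]
  simp [typeIForm, planeForm, spaceForm, hP, mul_comm, add_comm, ← sub_eq_add_neg]

theorem formEquiv_typeIIIForm (hb : IsEpicentralFrame c u₀ l b) (hμ : μ u₀ = 0) (hμ0 : μ ≠ 0)
    (h : ∀ ν : U →ₗ[F] F, ν u₀ = 0 → ∃ a : F, ν = a • μ) : FormEquiv c (typeIIIForm F) := by
  obtain ⟨v, hv⟩ := hb.exists_contraction_eq μ
  obtain ⟨z, -, hz⟩ := exists_apply_eq_zero_of_forall_ne_smul (f := 0) (g := μ ∘ₗ c (b 4))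
    fun a ha => hμ0 (hb.eq_zero_of_comp_eq_zero hμ (by simpa using ha))
  obtain ⟨b', hb', rfl, rfl, b'_four⟩ := hb.exists_extending (x₀ := v) (x₁ := z)
    (by rw [← hz, ← hv, LinearMap.compr₂_apply])
  have comp_eq : μ ∘ₗ c (b' 4) = b'.coord 1 := by
    rw [b'_four, ← hv, hb'.isSymplecticBasis.apply_zero]
  have μ_eq := hb'.compr₂_eq_wedge hμ (z := b' 1) (by rw [← LinearMap.comp_apply, comp_eq]; simp)
  obtain ⟨P, hP⟩ := exists_adapted_coordinates b' (g := μ ∘ₗ c (b' 1)) (by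
    rw [LinearMap.comp_apply, ← hb.isAlt.neg, map_neg, ← LinearMap.comp_apply, comp_eq]; simp)
  have injective_Q : Function.Injective (LinearMap.pi ![l, μ]) := by
    refine (injective_iff_map_eq_zero _).2 fun u hu =>
      hb.eq_zero_of_apply_eq_zero (congrFun hu 0) fun ν hν => ?_
    obtain ⟨a, rfl⟩ := h ν hν
    rw [LinearMap.smul_apply, show μ u = 0 from congrFun hu 1, smul_zero]
  refine .of_injective (map₂_planeSum_eq_top (map₂_spaceFormPair_eq_top F) _) P injective_Q
    fun x y => funext fun i => ?_
  have l_apply := LinearMap.congr_fun₂ hb'.isSymplecticBasis x y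
  have μ_apply := LinearMap.congr_fun₂ μ_eq x y
  rw [LinearMap.compr₂_apply] at l_apply μ_apply
  fin_cases i <;>
    simp [typeIIIForm, planeForm, spaceFormPair, hP, l_apply, μ_apply, comp_eq, mul_comm, add_comm,
      ← sub_eq_add_neg]

theorem formEquiv_typeIIForm (hb : IsEpicentralFrame c u₀ l b) (hμ : μ u₀ = 0) (hν : ν u₀ = 0)
    {v w : V} (hv : c.compr₂ l v = μ ∘ₗ c (b 4)) (hw : c.compr₂ l w = ν ∘ₗ c (b 4))
    (hvw : l (c v w) = 1) : FormEquiv c (typeIIForm F) := by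
  have μ_ne_zero : μ ≠ 0 := by
    rintro rfl
    simpa [hvw] using LinearMap.congr_fun hv w
  have exists_eq_add (φ : U →ₗ[F] F) (hφ : φ u₀ = 0) : ∃ a a' : F, φ = a • μ + a' • ν := by
    obtain ⟨d, hd⟩ := hb.exists_contraction_eq φ
    obtain ⟨a, ha⟩ := hb.exists_eq_smul_of_isotropic (ν := φ - l (c v d) • ν)
      (w := d - l (c v d) • w) hμ (by simp [hφ, hν]) μ_ne_zero hv
      (by rw [map_sub, map_smul, hd, hw, LinearMap.sub_comp, LinearMap.smul_comp]) (by simp [hvw])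
    exact ⟨a, _, sub_eq_iff_eq_add.1 ha⟩
  obtain ⟨b', hb', rfl, rfl, b'_four⟩ := hb.exists_extending hvw
  have comp_μ : μ ∘ₗ c (b' 4) = b'.coord 1 := by
    rw [b'_four, ← hv, hb'.isSymplecticBasis.apply_zero]
  have comp_ν : ν ∘ₗ c (b' 4) = -b'.coord 0 := by
    rw [b'_four, ← hw, hb'.isSymplecticBasis.apply_one]
  obtain ⟨g, hg, hμg, hνg⟩ := hb'.compr₂_eq_wedge_pair hμ hν (z := b' 1) (z' := -b' 0)
    (by rw [← LinearMap.comp_apply, comp_μ]; simp) (by rw [← LinearMap.comp_apply, comp_ν]; simp)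
    (by rw [← LinearMap.comp_apply, comp_ν]; simp)
  obtain ⟨P, hP⟩ := exists_adapted_coordinates b' hg
  have injective_Q : Function.Injective (LinearMap.pi ![l, μ, ν]) := by
    refine (injective_iff_map_eq_zero _).2 fun u hu =>
      hb.eq_zero_of_apply_eq_zero (congrFun hu 0) fun φ hφ => ?_
    obtain ⟨a, a', rfl⟩ := exists_eq_add φ hφ
    rw [LinearMap.add_apply, LinearMap.smul_apply, LinearMap.smul_apply,
      show μ u = 0 from congrFun hu 1, show ν u = 0 from congrFun hu 2, smul_zero, smul_zero,
      add_zero]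
  refine .of_injective (map₂_planeSum_eq_top (map₂_spaceFormTriple_eq_top F) _) P injective_Q
    fun x y => funext fun i => ?_
  have l_apply := LinearMap.congr_fun₂ hb'.isSymplecticBasis x y
  have μ_apply := LinearMap.congr_fun₂ hμg x y
  have ν_apply := LinearMap.congr_fun₂ hνg x y
  rw [LinearMap.compr₂_apply] at l_apply μ_apply ν_apply
  fin_cases i <;>
    simp [typeIIForm, planeForm, spaceFormTriple, hP, l_apply, μ_apply, ν_apply, comp_μ, comp_ν,
      mul_comm, add_comm, ← sub_eq_add_neg]

end IsEpicentralFrame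

theorem IsEpicentral.formEquiv (hc : c.IsAlt) (hs : Submodule.map₂ c ⊤ ⊤ = ⊤)
    (hV : finrank F V = 5) (hu : IsEpicentral c u₀) (hu₀ : u₀ ≠ 0) :
    FormEquiv c (typeIForm F) ∨ FormEquiv c (typeIIForm F) ∨ FormEquiv c (typeIIIForm F) := by
  obtain ⟨l, hl⟩ := Module.Projective.exists_dual_eq_one F hu₀
  obtain ⟨b, hb⟩ := hu.exists_isSymplecticBasis hc hl hV
  have hb : IsEpicentralFrame c u₀ l b := ⟨hc, hs, hu, hl, hb⟩
  by_cases trivial_annihilator : ∀ μ : U →ₗ[F] F, μ u₀ = 0 → μ = 0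
  · exact .inl (hb.formEquiv_typeIForm trivial_annihilator)
  push Not at trivial_annihilator
  obtain ⟨μ, hμ, hμ0⟩ := trivial_annihilator
  obtain ⟨v, hv⟩ := hb.exists_contraction_eq μ
  by_cases isotropic : ∀ ν w, ν u₀ = 0 → c.compr₂ l w = ν ∘ₗ c (b 4) → l (c v w) = 0
  · refine .inr (.inr (hb.formEquiv_typeIIIForm hμ hμ0 fun ν hν => ?_))
    obtain ⟨w, hw⟩ := hb.exists_contraction_eq ν
    exact hb.exists_eq_smul_of_isotropic hμ hν hμ0 hv hw (isotropic ν w hν hw)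
  · push Not at isotropic
    obtain ⟨ν, w, hν, hw, hvw⟩ := isotropic
    refine .inr (.inl (hb.formEquiv_typeIIForm (ν := (l (c v w))⁻¹ • ν) (w := (l (c v w))⁻¹ • w)
      hμ (by simp [hν]) hv ?_ (by simp [hvw])))
    rw [map_smul, hw, LinearMap.smul_comp]

end Classification

theorem BaerGroup.not_isCapable_planeSum {F W U : Type*} [Field F] [NeZero (2 : F)]
    [AddCommGroup W] [Module F W] [AddCommGroup U] [Module F U] {c : W →ₗ[F] W →ₗ[F] U}
    (hc : c.IsAlt) {y y' : W} {u : U} (hu : u ≠ 0) (hy : c y y' = u) :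
    ¬ IsCapable.{_, v} (BaerGroup (planeSum c u)) := by
  have plane_eq : planeSum c u (Pi.single 0 1, 0) (Pi.single 1 1, 0) = u := by
    simp [planeForm]
  refine not_isCapable (isAlt_planeSum hc _) LinearMap.isCompl_range_inl_inr.sup_eq_top ?_
    (x := (Pi.single 0 1, 0)) (x' := (Pi.single 1 1, 0)) (y := (0, y)) (y' := (0, y'))
    ⟨_, rfl⟩ ⟨_, rfl⟩ ⟨_, rfl⟩ ⟨_, rfl⟩ (by simp [plane_eq, hy]) (by rwa [plane_eq])
  rintro _ ⟨x, rfl⟩ _ ⟨y, rfl⟩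
  simp

section Amalgam

variable {A B M : Type*} [Group A] [Group B] [Group M] {α : A →* M} {β : B →* M} {a₀ : A} {b₀ : B}

theorem mem_center_of_apply_eq_apply (hα : Function.Injective α)
    (hcomm : ∀ a b, Commute (α a) (β b)) (h₀ : α a₀ = β b₀) : a₀ ∈ Subgroup.center A :=
  Subgroup.mem_center_iff.2 fun a => hα <| by rw [map_mul, map_mul, h₀, (hcomm a b₀).eq]

theorem ker_noncommCoprod_eq_amalgamSubgroup {H : Subgroup (Subgroup.center A)}
    {φ : H →* Subgroup.center B} (hβ : Function.Injective β) (hcomm : ∀ a b, Commute (α a) (β b))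
    (hφ : ∀ h : H, α (h : Subgroup.center A) = β (φ h))
    (hinter : ∀ a b, α a = β b → a ∈ H.map (Subgroup.center A).subtype) :
    (α.noncommCoprod β hcomm).ker = amalgamSubgroup H φ := by
  ext ⟨a, b⟩
  rw [MonoidHom.mem_ker, MonoidHom.noncommCoprod_apply]
  constructor
  · intro hab
    have α_a : α a = β b⁻¹ := by rwa [map_inv, ← mul_eq_one_iff_eq_inv]
    obtain ⟨h, hh, rfl⟩ := hinter _ _ α_a
    refine ⟨⟨h, hh⟩, Prod.ext rfl (inv_injective (hβ ?_))⟩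
    rw [← α_a, inv_inv, ← hφ]
    rfl
  · rintro ⟨h, hab⟩
    obtain ⟨rfl, rfl⟩ := Prod.mk.inj hab
    rw [hφ, map_inv, mul_inv_cancel]

theorem nonempty_amalgamatedProduct_mulEquiv {H : Subgroup (Subgroup.center A)}
    {φ : H →* Subgroup.center B} (hβ : Function.Injective β) (hcomm : ∀ a b, Commute (α a) (β b))
    (hsup : α.range ⊔ β.range = ⊤) (h₀ : α a₀ = β b₀)
    (hinter : ∀ a b, α a = β b → a ∈ Subgroup.zpowers a₀)
    (hH : H.map (Subgroup.center A).subtype = Subgroup.zpowers a₀)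
    (hφ : ∃ h : H, ((h : Subgroup.center A) : A) = a₀ ∧ (φ h : B) = b₀) :
    Nonempty (AmalgamatedProduct H φ ≃* M) := by
  have surjective : Function.Surjective (α.noncommCoprod β hcomm) := by
    rwa [← MonoidHom.range_eq_top, MonoidHom.noncommCoprod_range]
  have α_eq_β (h : H) : α (h : Subgroup.center A) = β (φ h) := by
    obtain ⟨h', rfl, rfl⟩ := hφ
    obtain ⟨k, hk⟩ : ((h : Subgroup.center A) : A) ∈ Subgroup.zpowers _ :=
      hH ▸ Subgroup.mem_map_of_mem _ h.2
    obtain rfl : h' ^ k = h := Subtype.ext (Subtype.ext (by simpa using hk))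
    simpa using congrArg (· ^ k) h₀
  have ker_eq := ker_noncommCoprod_eq_amalgamSubgroup hβ hcomm α_eq_β fun a b hab =>
    hH ▸ hinter a b hab
  exact ⟨(QuotientGroup.quotientMulEquivOfEq ker_eq).symm.trans
    (QuotientGroup.quotientKerEquivOfSurjective _ surjective)⟩

theorem isAmalgam_iff_nonempty_mulEquiv {G : Type*} [Group G] (hα : Function.Injective α)
    (hβ : Function.Injective β) (hcomm : ∀ a b, Commute (α a) (β b))
    (hsup : α.range ⊔ β.range = ⊤) (h₀ : α a₀ = β b₀)
    (hinter : ∀ a b, α a = β b → a ∈ Subgroup.zpowers a₀) :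
    IsAmalgam G a₀ b₀ ↔ Nonempty (G ≃* M) := by
  constructor
  · rintro ⟨H, φ, hH, -, hφ, ⟨e⟩⟩
    obtain ⟨f⟩ := nonempty_amalgamatedProduct_mulEquiv hβ hcomm hsup h₀ hinter hH hφ
    exact ⟨e.trans f⟩
  · rintro ⟨e⟩
    let a₁ : Subgroup.center A := ⟨a₀, mem_center_of_apply_eq_apply hα hcomm h₀⟩
    let b₁ : Subgroup.center B :=
      ⟨b₀, mem_center_of_apply_eq_apply hβ (fun b a => (hcomm a b).symm) h₀.symm⟩
    have exists_preimage (h : Subgroup.zpowers a₁) :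
        ∃ b : Subgroup.center B, β b = α (h : Subgroup.center A) := by
      obtain ⟨_, k, rfl⟩ := h
      exact ⟨b₁ ^ k, by simp [a₁, b₁, h₀]⟩
    choose φ β_φ using exists_preimage
    let φ' : Subgroup.zpowers a₁ →* Subgroup.center B :=
      .mk' φ fun x y => Subtype.ext (hβ (by simp [β_φ]))
    have map_zpowers : (Subgroup.zpowers a₁).map (Subgroup.center A).subtype =
        Subgroup.zpowers a₀ := MonoidHom.map_zpowers _ _
    have φ_a₁ : ∃ h : Subgroup.zpowers a₁, ((h : Subgroup.center A) : A) = a₀ ∧ (φ' h : B) = b₀ :=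
      ⟨⟨a₁, Subgroup.mem_zpowers _⟩, rfl, hβ ((β_φ _).trans h₀)⟩
    obtain ⟨f⟩ := nonempty_amalgamatedProduct_mulEquiv hβ hcomm hsup h₀ hinter map_zpowers φ_a₁
    refine ⟨_, φ', map_zpowers, fun x y hxy => Subtype.ext (Subtype.ext (hα ?_)), φ_a₁,
      ⟨e.trans f.symm⟩⟩
    rw [← β_φ, ← β_φ]
    exact congrArg (fun b : Subgroup.center B => β b) hxy

end Amalgam

theorem isAmalgam_iff_baerGroup_planeSum {p : ℕ} [Fact p.Prime] {W U : Type*} [AddCommGroup W]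
    [Module (ZMod p) W] [AddCommGroup U] [Module (ZMod p) U] {c : W →ₗ[ZMod p] W →ₗ[ZMod p] U}
    {A B G : Type*} [Group A] [Group B] [Group G] {t : ZMod p} {u : U} (ht : t ≠ 0)
    (hu : u ≠ 0) (eA : A ≃* BaerGroup (planeForm (ZMod p))) (eB : B ≃* BaerGroup c)
    {a : A} {b : B} (ha : eA a = ⟨0, t⟩) (hb : eB b = ⟨0, t • u⟩) :
    IsAmalgam G a b ↔ Nonempty (G ≃* BaerGroup (planeSum c u)) := by
  let α : BaerGroup (planeForm (ZMod p)) →* BaerGroup (planeSum c u) :=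
    BaerGroup.map (LinearMap.inl _ _ _) (LinearMap.toSpanSingleton _ _ u) (by simp)
  let β : BaerGroup c →* BaerGroup (planeSum c u) :=
    BaerGroup.map (LinearMap.inr _ _ _) LinearMap.id (by simp)
  have injective_α : Function.Injective α := fun x y hxy => BaerGroup.ext
    (LinearMap.inl_injective (congrArg BaerGroup.fst hxy))
    (smul_left_injective _ hu (congrArg BaerGroup.snd hxy))
  have injective_β : Function.Injective β := fun x y hxy => BaerGroup.ext
    (LinearMap.inr_injective (congrArg BaerGroup.fst hxy))
    (congrArg (fun z : BaerGroup (planeSum c u) => z.snd) hxy)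
  refine isAmalgam_iff_nonempty_mulEquiv (α := α.comp eA.toMonoidHom) (β := β.comp eB.toMonoidHom)
    (injective_α.comp eA.injective) (injective_β.comp eB.injective) (fun x y => ?_)
    (eq_top_iff.2 fun x _ => ?_) ?_ fun x y hxy => ?_
  · ext : 1 <;> simp [α, β, add_comm]
  · have eq_mul : x = α ⟨x.fst.1, 0⟩ * β ⟨x.fst.2, x.snd⟩ := by ext : 1 <;> simp [α, β]
    rw [eq_mul, ← eA.apply_symm_apply ⟨_, 0⟩, ← eB.apply_symm_apply ⟨_, x.snd⟩]
    exact Subgroup.mul_mem_sup ⟨_, rfl⟩ ⟨_, rfl⟩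
  · ext : 1 <;> simp [ha, hb, α, β]
  · have fst_eq_zero : (eA x).fst = 0 :=
      congrArg (fun z : BaerGroup (planeSum c u) => z.fst.1) hxy
    refine ⟨((eA x).snd * t⁻¹).val, eA.injective ?_⟩
    beta_reduce
    rw [zpow_natCast, map_pow, ha, BaerGroup.pow_eq (isAlt_planeForm _)]
    ext : 1 <;> simp [fst_eq_zero, ht]

section PowPrime

variable {G : Type*} [Group G]

theorem pow_mul_eq_mul_commutator_pow_mul_pow {x y : G} (hx : Commute ⁅y, x⁆ x)
    (hy : Commute ⁅y, x⁆ y) (n : ℕ) : y ^ n * x = x * (⁅y, x⁆ ^ n * y ^ n) := by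
  have semiconj : SemiconjBy x (⁅y, x⁆ * y) y := by
    rw [SemiconjBy, ← mul_assoc, ← hx.eq, commutatorElement_def]
    group
  rw [← hy.mul_pow, (semiconj.pow_right n).eq]

theorem mul_pow_eq_commutator_pow_choose_mul {x y : G} (hx : Commute ⁅y, x⁆ x)
    (hy : Commute ⁅y, x⁆ y) (n : ℕ) :
    (x * y) ^ n = ⁅y, x⁆ ^ n.choose 2 * (x ^ n * y ^ n) := by
  induction n with
  | zero => simp
  | succ n ih =>
    have collect : y ^ n * x = ⁅y, x⁆ ^ n * (x * y ^ n) := by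
      rw [pow_mul_eq_mul_commutator_pow_mul_pow hx hy, ← mul_assoc, ← (hx.pow_left n).eq, mul_assoc]
    have choose_succ : (n + 1).choose 2 = n.choose 2 + n := by
      rw [Nat.choose_succ_succ' n 1, Nat.choose_one_right, add_comm]
    calc (x * y) ^ (n + 1) = ⁅y, x⁆ ^ n.choose 2 * (x ^ n * (y ^ n * x) * y) := by
          rw [pow_succ, ih]; simp only [mul_assoc]
      _ = ⁅y, x⁆ ^ n.choose 2 * (⁅y, x⁆ ^ n * x ^ n * (x * y ^ n) * y) := by
          rw [collect, ← mul_assoc (x ^ n), ← (hx.pow_pow n n).eq]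
      _ = ⁅y, x⁆ ^ (n + 1).choose 2 * (x ^ (n + 1) * y ^ (n + 1)) := by
          rw [choose_succ, pow_add, pow_succ x, pow_succ y]
          simp only [mul_assoc]

theorem isClassTwoExp_of_closure {p : ℕ} (hp : Odd p) (hcomm : ∀ x y z : G, Commute ⁅x, y⁆ z)
    {S : Set G} (hS : Subgroup.closure S = ⊤) (hpow : ∀ x ∈ S, x ^ p = 1) : IsClassTwoExp p G := by
  refine ⟨hcomm, fun x => ?_⟩
  have hx : x ∈ Subgroup.closure S := hS ▸ Subgroup.mem_top x
  induction hx using Subgroup.closure_induction with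
  | mem x hx => exact hpow x hx
  | one => exact one_pow p
  | mul x y _ _ hx hy =>
    have commutator_pow : ⁅y, x⁆ ^ p = 1 := by
      simpa [hy] using pow_mul_eq_mul_commutator_pow_mul_pow (hcomm y x x) (hcomm y x y) p
    have dvd_choose : p ∣ p.choose 2 := by
      obtain ⟨k, rfl⟩ := hp
      exact ⟨k, by rw [Nat.choose_two_right, Nat.add_sub_cancel, mul_left_comm,
        Nat.mul_div_cancel_left _ two_pos]⟩
    obtain ⟨k, hk⟩ := dvd_choose
    rw [mul_pow_eq_commutator_pow_choose_mul (hcomm y x x) (hcomm y x y), hx, hy, hk, pow_mul,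
      commutator_pow, one_pow, one_mul, one_mul]
  | inv x _ hx => rw [inv_pow, hx, inv_one]

theorem IsClassTwoExp.of_surjective {p : ℕ} {H : Type*} [Group H] [IsClassTwoExp p G] {f : G →* H}
    (hf : Function.Surjective f) : IsClassTwoExp p H where
  commute_commutator := hf.forall₃.2 fun x y z => by
    rw [← map_commutatorElement]
    exact (commute_commutator p x y z).map f
  pow_eq_one := hf.forall.2 fun x => by rw [← map_pow, pow_eq_one, map_one]

end PowPrime

namespace NilCyclic

variable {p n : ℕ}

theorem closure_range_gen : Subgroup.closure (Set.range (gen p n)) = ⊤ := by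
  refine eq_top_iff.2 (QuotientGroup.mk_surjective.forall.2 fun x _ => ?_)
  induction x using Monoid.CoprodI.induction_on with
  | one => exact one_mem _
  | of i m =>
    obtain ⟨k, hk⟩ := ZMod.intCast_surjective m.toAdd
    have m_eq : m = Multiplicative.ofAdd (1 : ZMod p) ^ k := by
      rw [← ofAdd_zsmul, zsmul_one, hk, ofAdd_toAdd]
    rw [m_eq, map_zpow, QuotientGroup.mk_zpow]
    exact zpow_mem (Subgroup.subset_closure (Set.mem_range_self i)) k
  | mul x y hx hy => exact mul_mem (hx trivial) (hy trivial)

theorem gen_pow (i : Fin n) : gen p n i ^ p = 1 := by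
  rw [gen, ← QuotientGroup.mk_pow, ← map_pow, ← ofAdd_nsmul, nsmul_one, ZMod.natCast_self,
    ofAdd_zero, map_one, QuotientGroup.mk_one]

instance isClassTwoExp [Fact (Odd p)] : IsClassTwoExp p (NilCyclic p n) :=
  isClassTwoExp_of_closure Fact.out
    (fun x y z => (Subgroup.mem_center_iff.1 (commutator_mem_center x y) z).symm)
    closure_range_gen (Set.forall_mem_range.2 gen_pow)

theorem exists_monoidHom_gen_eq {M : Type*} [Group M] (hM : IsClassLE 2 M) {y : Fin n → M}
    (hy : ∀ i, y i ^ p = 1) : ∃ φ : NilCyclic p n →* M, ∀ i, φ (gen p n i) = y i := by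
  have multiples_eq_zero (i : Fin n) : zmultiplesHom (Additive M) (.ofMul (y i)) p = 0 := by
    rw [zmultiplesHom_apply, natCast_zsmul, ← ofMul_pow, hy, ofMul_one]
  let f (i : Fin n) : Multiplicative (ZMod p) →* M :=
    AddMonoidHom.toMultiplicativeLeft (ZMod.lift p ⟨_, multiples_eq_zero i⟩)
  have f_one (i : Fin n) : f i (.ofAdd 1) = y i := by
    have := ZMod.lift_coe p ⟨_, multiples_eq_zero i⟩ 1
    rw [Int.cast_one, zmultiplesHom_apply, one_zsmul] at this
    exact congrArg Additive.toMul this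
  let F := Monoid.CoprodI.lift f
  have lowerCentralSeries_le : (⊤ : Subgroup (Monoid.CoprodI
      fun _ : Fin n => Multiplicative (ZMod p))).lowerCentralSeries 2 ≤ F.ker := by
    rw [← MonoidHom.comap_bot, ← Subgroup.map_le_iff_le_comap, Subgroup.map_lowerCentralSeries]
    exact (Subgroup.lowerCentralSeries_mono 2 le_top).trans hM.le
  refine ⟨QuotientGroup.lift _ F lowerCentralSeries_le, fun i => ?_⟩
  rw [gen, QuotientGroup.lift_mk, Monoid.CoprodI.lift_of, f_one]

end NilCyclic

theorem BaerLie.bijective_of_apply_eq_mk_basis {p : ℕ} [Fact p.Prime] [Fact (Odd p)]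
    {V U : Type*} [AddCommGroup V] [Module (ZMod p) V] [AddCommGroup U] [Module (ZMod p) U]
    {c : V →ₗ[ZMod p] V →ₗ[ZMod p] U} (hc : c.IsAlt) (hs : Submodule.map₂ c ⊤ ⊤ = ⊤)
    {H ι : Type*} [Group H] [IsClassTwoExp p H] {y : ι → H}
    (hy : Subgroup.closure (Set.range y) = ⊤) (b : Basis ι (ZMod p) V)
    (g : U →ₗ[ZMod p] BaerLie p H)
    (hg : ∀ i j, g (c (b i) (b j)) = bracket p (of p (y i)) (of p (y j)))
    {α : H →* BaerGroup c} (hα : ∀ i, α (y i) = ⟨b i, 0⟩) : Function.Bijective α := by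
  let f : V →ₗ[ZMod p] BaerLie p H := b.constr (ZMod p) fun i => of p (y i)
  have compatible (v w : V) : g (c v w) = bracket p (f v) (f w) := by
    have : c.compr₂ g = (bracket p).compl₁₂ f f := b.ext fun i => b.ext fun j => by
      simp [f, hg]
    exact congr($this v w)
  let L : BaerGroup c →* H := lift f g (bracket_apply_eq_zero compatible hs) compatible
  have L_mk (i : ι) : L ⟨b i, 0⟩ = y i := (of p).injective <| by
    rw [of_lift, map_zero, add_zero, b.constr_basis]
  have surjective_L : Function.Surjective L := by
    rw [← MonoidHom.range_eq_top, ← top_le_iff, ← hy, Subgroup.closure_le, Set.range_subset_iff]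
    exact fun i => ⟨_, L_mk i⟩
  have α_L : (α.comp L).eqLocus (.id _) = ⊤ :=
    BaerGroup.eq_top_of_mk_mem hc hs b.span_eq fun i => (congrArg α (L_mk i)).trans (hα i)
  have leftInverse : Function.LeftInverse α L := fun x => α_L.ge trivial
  exact ⟨(leftInverse.rightInverse_of_surjective surjective_L).injective, leftInverse.surjective⟩

namespace NilCyclicThreeMod

variable (p : ℕ)

/-- The generators of the quotient of a `2`-nilpotent product, namely the images of the generators
of the three cyclic factors. -/
def gen (i : Fin 3) : NilCyclicThreeMod p := QuotientGroup.mk' _ (NilCyclic.gen p 3 i)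

instance isClassTwoExp [Fact (Odd p)] : IsClassTwoExp p (NilCyclicThreeMod p) :=
  .of_surjective (QuotientGroup.mk'_surjective _)

theorem closure_range_gen : Subgroup.closure (Set.range (gen p)) = ⊤ := by
  rw [← Subgroup.map_top_of_surjective _ (QuotientGroup.mk'_surjective
    (Subgroup.zpowers ⁅NilCyclic.gen p 3 2, NilCyclic.gen p 3 1⁆)),
    ← NilCyclic.closure_range_gen, MonoidHom.map_closure, ← Set.range_comp]
  rfl

theorem commute_gen_two_gen_one : Commute (gen p 2) (gen p 1) :=
  commutatorElement_eq_one_iff_commute.1 ((QuotientGroup.eq_one_iff _).2 (Subgroup.mem_zpowers _))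

theorem exists_monoidHom_gen_eq {M : Type*} [Group M] (hM : IsClassLE 2 M) {y : Fin 3 → M}
    (hy : ∀ i, y i ^ p = 1) (h : Commute (y 2) (y 1)) :
    ∃ φ : NilCyclicThreeMod p →* M, ∀ i, φ (gen p i) = y i := by
  obtain ⟨φ, hφ⟩ := NilCyclic.exists_monoidHom_gen_eq hM hy
  refine ⟨QuotientGroup.lift _ φ ?_, hφ⟩
  rw [Subgroup.zpowers_le, MonoidHom.mem_ker, map_commutatorElement, hφ, hφ, h.commutator_eq]

end NilCyclicThreeMod

section NilCyclic

variable {p : ℕ} [Fact p.Prime] [Fact (Odd p)]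

open BaerLie

theorem NilCyclic.exists_mulEquiv_baerGroup {n : ℕ} {U : Type*} [AddCommGroup U]
    [Module (ZMod p) U] {c : (Fin n → ZMod p) →ₗ[ZMod p] (Fin n → ZMod p) →ₗ[ZMod p] U}
    (hc : c.IsAlt) (hs : Submodule.map₂ c ⊤ ⊤ = ⊤) (g : U →ₗ[ZMod p] BaerLie p (NilCyclic p n))
    (hg : ∀ i j, g (c (Pi.single i 1) (Pi.single j 1)) =
      bracket p (of p (gen p n i)) (of p (gen p n j))) :
    ∃ e : NilCyclic p n ≃* BaerGroup c, ∀ i, e (gen p n i) = ⟨Pi.single i 1, 0⟩ := by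
  have class_two := BaerGroup.isClassTwoExp hc
  obtain ⟨α, hα⟩ := exists_monoidHom_gen_eq (isClassLE_two_iff.2 class_two.commute_commutator)
    fun i : Fin n => class_two.pow_eq_one ⟨Pi.single i 1, 0⟩
  exact ⟨MulEquiv.ofBijective α (bijective_of_apply_eq_mk_basis hc hs closure_range_gen
    (Pi.basisFun _ _) g (by simpa using hg) (by simpa using hα)), hα⟩

variable (p)

theorem NilCyclic.exists_mulEquiv_planeForm :
    ∃ e : NilCyclic p 2 ≃* BaerGroup (planeForm (ZMod p)),
      ∀ i, e (gen p 2 i) = ⟨Pi.single i 1, 0⟩ := by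
  refine exists_mulEquiv_baerGroup (isAlt_planeForm _) (map₂_planeForm_eq_top _)
    (LinearMap.toSpanSingleton _ _ (bracket p (of p (gen p 2 0)) (of p (gen p 2 1)))) ?_
  intro i j
  fin_cases i <;> fin_cases j <;>
    simp [planeForm, (isAlt_bracket p).self_eq_zero, (isAlt_bracket p).neg]

theorem NilCyclic.exists_mulEquiv_spaceFormTriple :
    ∃ e : NilCyclic p 3 ≃* BaerGroup (spaceFormTriple (ZMod p)),
      ∀ i, e (gen p 3 i) = ⟨Pi.single i 1, 0⟩ := by
  refine exists_mulEquiv_baerGroup (isAlt_spaceFormTriple _) (map₂_spaceFormTriple_eq_top _)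
    (Fintype.linearCombination _ ![bracket p (of p (gen p 3 0)) (of p (gen p 3 1)),
      bracket p (of p (gen p 3 0)) (of p (gen p 3 2)),
      bracket p (of p (gen p 3 1)) (of p (gen p 3 2))]) ?_
  intro i j
  fin_cases i <;> fin_cases j <;>
    simp [spaceFormTriple, Fintype.linearCombination_apply, Fin.sum_univ_three,
      (isAlt_bracket p).self_eq_zero, (isAlt_bracket p).neg]

theorem NilCyclicThreeMod.exists_mulEquiv_spaceFormPair :
    ∃ e : NilCyclicThreeMod p ≃* BaerGroup (spaceFormPair (ZMod p)),
      ∀ i, e (gen p i) = ⟨Pi.single i 1, 0⟩ := by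
  have hc := isAlt_spaceFormPair (ZMod p)
  have class_two := BaerGroup.isClassTwoExp hc
  have commute : Commute (⟨Pi.single 2 1, 0⟩ : BaerGroup (spaceFormPair (ZMod p)))
      ⟨Pi.single 1 1, 0⟩ := by
    rw [← commutatorElement_eq_one_iff_commute, BaerGroup.commutator_eq hc]
    ext i
    · simp
    · fin_cases i <;> simp [spaceFormPair]
  obtain ⟨α, hα⟩ := exists_monoidHom_gen_eq p
    (isClassLE_two_iff.2 class_two.commute_commutator)
    (y := fun i => ⟨Pi.single i 1, 0⟩) (fun _ => class_two.pow_eq_one _) commute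
  have bracket_gen : bracket p (of p (gen p 2)) (of p (gen p 1)) = 0 := by
    rw [bracket_of, (commute_gen_two_gen_one p).commutator_eq, of_one]
  have bracket_gen_swap := (isAlt_bracket p).eq_iff.1 bracket_gen
  refine ⟨MulEquiv.ofBijective α (bijective_of_apply_eq_mk_basis hc (map₂_spaceFormPair_eq_top _)
    (closure_range_gen p) (Pi.basisFun _ _)
    (Fintype.linearCombination _ ![bracket p (of p (gen p 0)) (of p (gen p 1)),
      bracket p (of p (gen p 0)) (of p (gen p 2))]) (fun i j => ?_) (by simpa using hα)), hα⟩
  fin_cases i <;> fin_cases j <;>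
    simp [spaceFormPair, Fintype.linearCombination_apply,
      (isAlt_bracket p).self_eq_zero, (isAlt_bracket p).neg, bracket_gen, bracket_gen_swap]

end NilCyclic

section Types

variable {p : ℕ} [Fact p.Prime] [Fact (Odd p)] {G : Type*} [Group G]

theorem isTypeII_iff : IsTypeII p G ↔ Nonempty (G ≃* BaerGroup (typeIIForm (ZMod p))) := by
  obtain ⟨eA, hA⟩ := NilCyclic.exists_mulEquiv_planeForm p
  obtain ⟨eB, hB⟩ := NilCyclic.exists_mulEquiv_spaceFormTriple p
  refine isAmalgam_iff_baerGroup_planeSum (t := -1) (by simp) (by simp) eA eB ?_ ?_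
  · rw [map_commutatorElement, hA, hA, BaerGroup.commutator_eq (isAlt_planeForm _)]
    simp [planeForm]
  · rw [map_commutatorElement, hB, hB, BaerGroup.commutator_eq (isAlt_spaceFormTriple _)]
    ext i
    · simp
    · fin_cases i <;> simp [spaceFormTriple]

theorem isTypeIII_iff : IsTypeIII p G ↔ Nonempty (G ≃* BaerGroup (typeIIIForm (ZMod p))) := by
  obtain ⟨eA, hA⟩ := NilCyclic.exists_mulEquiv_planeForm p
  obtain ⟨eB, hB⟩ := NilCyclicThreeMod.exists_mulEquiv_spaceFormPair p
  refine isAmalgam_iff_baerGroup_planeSum (t := -1) (by simp) (by simp) eA eB ?_ ?_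
  · rw [map_commutatorElement, hA, hA, BaerGroup.commutator_eq (isAlt_planeForm _)]
    simp [planeForm]
  · change eB ⁅NilCyclicThreeMod.gen p 1, NilCyclicThreeMod.gen p 0⁆ = _
    rw [map_commutatorElement, hB, hB, BaerGroup.commutator_eq (isAlt_spaceFormPair _)]
    ext i
    · simp
    · fin_cases i <;> simp [spaceFormPair]

end Types

theorem IsExtraSpecial.of_mulEquiv {p : ℕ} {E E' : Type*} [Group E] [Group E'] (e : E ≃* E')
    (h : IsExtraSpecial p E) : IsExtraSpecial p E' where
  isPGroup := h.isPGroup.of_equiv e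
  card_center := (Nat.card_congr (Subgroup.centerCongr e).toEquiv).symm.trans h.card_center
  commutator_eq_center := by
    have map_commutator : (commutator E).map e.toMonoidHom = commutator E' := by
      rw [commutator_def, commutator_def, Subgroup.map_commutator,
        Subgroup.map_top_of_surjective _ e.surjective]
    ext x
    rw [← map_commutator, h.commutator_eq_center, Subgroup.mem_map_equiv]
    exact MulEquivClass.apply_mem_center_iff e.symm
  pow_mem_center := e.surjective.forall.2 fun x => by
    rw [← map_pow]
    exact MulEquivClass.apply_mem_center e (h.pow_mem_center x)

theorem IsExtraSpecial.isClassTwoExp {p : ℕ} {E : Type*} [Group E] (hE : IsExtraSpecial p E)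
    (hexp : Monoid.exponent E = p) : IsClassTwoExp p E where
  commute_commutator x y z := (Subgroup.mem_center_iff.1 (hE.commutator_eq_center.le
    (Subgroup.commutator_mem_commutator (Subgroup.mem_top x) (Subgroup.mem_top y))) z).symm
  pow_eq_one x := hexp ▸ Monoid.pow_exponent_eq_one x

theorem BaerGroup.isExtraSpecial_iff {p : ℕ} [Fact p.Prime] [NeZero (2 : ZMod p)] {V U : Type*}
    [AddCommGroup V] [Module (ZMod p) V] [AddCommGroup U] [Module (ZMod p) U]
    {c : V →ₗ[ZMod p] V →ₗ[ZMod p] U} (hc : c.IsAlt) (hs : Submodule.map₂ c ⊤ ⊤ = ⊤) :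
    IsExtraSpecial p (BaerGroup c) ↔ Nat.card U = p ∧ c.SeparatingLeft := by
  rw [LinearMap.separatingLeft_iff_linear_nontrivial]
  have card_commutator : Nat.card (commutator (BaerGroup c)) = Nat.card U :=
    Nat.card_congr
      { toFun x := x.1.snd
        invFun u := ⟨⟨0, u⟩, (mem_commutator_iff hc hs).2 rfl⟩
        left_inv x := Subtype.ext (BaerGroup.ext ((mem_commutator_iff hc hs).1 x.2).symm rfl)
        right_inv _ := rfl }
  constructor
  · intro h
    refine ⟨by rw [← card_commutator, h.commutator_eq_center, h.card_center], fun v hv => ?_⟩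
    exact (mem_commutator_iff hc hs (x := ⟨v, 0⟩)).1
      (h.commutator_eq_center.ge ((mem_center_iff hc).2 hv))
  · rintro ⟨hU, nondegenerate⟩
    have commutator_eq_center : commutator (BaerGroup c) = Subgroup.center (BaerGroup c) := by
      ext x
      rw [mem_commutator_iff hc hs, mem_center_iff hc]
      exact ⟨fun hx => by rw [hx, map_zero], nondegenerate _⟩
    exact ⟨fun x => ⟨1, by rw [pow_one, pow_prime_eq_one hc]⟩,
      by rw [← commutator_eq_center, card_commutator, hU], commutator_eq_center,
      fun x => pow_prime_eq_one hc x ▸ one_mem _⟩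

section ExtraSpecialForm

variable {F V U : Type*} [Field F] [AddCommGroup V] [Module F V] [AddCommGroup U] [Module F U]

variable (F) in
theorem separatingLeft_extraSpecialForm : (extraSpecialForm F).SeparatingLeft := by
  intro x hx
  have h₀ : x.1 0 = 0 := by simpa [extraSpecialForm, planeForm] using hx (Pi.single 1 1, 0)
  have h₁ : x.1 1 = 0 := by simpa [extraSpecialForm, planeForm] using hx (Pi.single 0 1, 0)
  have h₂ : x.2 0 = 0 := by simpa [extraSpecialForm, planeForm] using hx (0, Pi.single 1 1)
  have h₃ : x.2 1 = 0 := by simpa [extraSpecialForm, planeForm] using hx (0, Pi.single 0 1)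
  ext i <;> fin_cases i <;> assumption

theorem ne_wedge_of_separatingLeft [FiniteDimensional F V] (hV : 2 < finrank F V)
    {ω : V →ₗ[F] V →ₗ[F] F} (h : ω.SeparatingLeft) (f g : V →ₗ[F] F) : ω ≠ wedge f g := by
  rintro rfl
  obtain ⟨x, hx, x_ne_zero⟩ := (Submodule.ne_bot_iff _).1
    ((f.prod g).ker_ne_bot_of_finrank_lt (by simpa using hV))
  obtain ⟨hf, hg⟩ : f x = 0 ∧ g x = 0 := by simpa using hx
  exact x_ne_zero (h x fun y => by simp [hf, hg])

theorem IsSymplecticQuadruple.formEquiv {ω : V →ₗ[F] V →ₗ[F] F} {v : Fin 4 → V}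
    (h : IsSymplecticQuadruple ω v) (hV : finrank F V = 4) :
    FormEquiv ω (extraSpecialForm F) := by
  let L : (Fin 2 → F) × (Fin 2 → F) →ₗ[F] V :=
    (Fintype.linearCombination F ![v 0, v 1]).coprod (Fintype.linearCombination F ![v 2, v 3])
  have isometry (x y) : ω (L x) (L y) = extraSpecialForm F x y := by
    simp [L, Fintype.linearCombination_apply, h _ _, extraSpecialForm, planeForm, mul_comm,
      ← sub_eq_add_neg]
  have injective_L : Function.Injective L := by
    rw [← LinearMap.ker_eq_bot, LinearMap.ker_eq_bot']
    intro x hx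
    refine separatingLeft_extraSpecialForm F x fun y => ?_
    rw [← isometry, hx, map_zero, LinearMap.zero_apply]
  have : FiniteDimensional F V := .of_finrank_eq_succ hV
  let P := LinearMap.linearEquivOfInjective L injective_L (by simp [hV])
  have L_symm (x) : L (P.symm x) = x := P.apply_symm_apply x
  refine ⟨P.symm, .refl F F, fun x y => ?_⟩
  rw [← isometry, L_symm, L_symm, LinearEquiv.refl_apply]

theorem formEquiv_extraSpecialForm {c : V →ₗ[F] V →ₗ[F] U} (hc : c.IsAlt) (h : c.SeparatingLeft)
    (hV : finrank F V = 4) (hU : finrank F U = 1) : FormEquiv c (extraSpecialForm F) := by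
  have : FiniteDimensional F V := .of_finrank_eq_succ hV
  obtain ⟨Q⟩ := nonempty_linearEquiv_of_finrank_eq_one hU
  let ω := c.compr₂ Q.symm.toLinearMap
  have separating_ω : ω.SeparatingLeft := fun x hx => h x fun y => by simpa [ω] using hx y
  have hω : ω.IsAlt := fun x => by simp [ω, hc.self_eq_zero]
  have : Nontrivial V := nontrivial_of_finrank_pos (R := F) (by omega)
  obtain ⟨x, hx⟩ := exists_ne (0 : V)
  obtain ⟨y, hy⟩ : ∃ y, ω x y ≠ 0 := by
    by_contra! hxy
    exact hx (separating_ω x hxy)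
  obtain ⟨x₂, x₃, quadruple⟩ := exists_isSymplecticQuadruple hω
    (ne_wedge_of_separatingLeft (by omega) separating_ω) (x₀ := (ω x y)⁻¹ • x) (x₁ := y)
    (by simp [hy])
  obtain ⟨P, Q', hPQ⟩ := quadruple.formEquiv hV
  exact ⟨P, Q.symm.trans Q', hPQ⟩

end ExtraSpecialForm

theorem BaerGroup.isExtraSpecial_extraSpecialForm (p : ℕ) [Fact p.Prime] [NeZero (2 : ZMod p)] :
    IsExtraSpecial p (BaerGroup (extraSpecialForm (ZMod p))) :=
  (isExtraSpecial_iff (isAlt_extraSpecialForm _) (map₂_extraSpecialForm_eq_top _)).2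
    ⟨Nat.card_zmod p, separatingLeft_extraSpecialForm _⟩

theorem BaerGroup.natCard_extraSpecialForm (F : Type*) [Field F] :
    Nat.card (BaerGroup (extraSpecialForm F)) = Nat.card F ^ 5 := by
  simp only [natCard_eq, Nat.card_prod, Nat.card_fun, Nat.card_eq_fintype_card,
    Fintype.card_fin]
  ring

theorem IsExtraSpecial.nonempty_mulEquiv_extraSpecialForm {p : ℕ} [Fact p.Prime]
    [Fact (Odd p)] {E : Type*} [Group E] (hE : IsExtraSpecial p E) (hcard : Nat.card E = p ^ 5)
    (hexp : Monoid.exponent E = p) :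
    Nonempty (E ≃* BaerGroup (extraSpecialForm (ZMod p))) := by
  have := hE.isClassTwoExp hexp
  obtain ⟨V, U, c, hc, hs, ⟨e⟩⟩ := IsClassTwoExp.exists_mulEquiv_baerGroup p E
  obtain ⟨card_U, separating⟩ := (BaerGroup.isExtraSpecial_iff hc hs).1 (hE.of_mulEquiv e)
  have p_pos := (Fact.out : p.Prime).pos
  have card_V : Nat.card V = p ^ 4 := by
    rw [Nat.card_congr e.toEquiv, BaerGroup.natCard_eq, card_U] at hcard
    exact Nat.eq_of_mul_eq_mul_right p_pos hcard
  have finrank_eq {W : Submodule (ZMod p) (BaerLie p E)} {n : ℕ} (h : Nat.card W = p ^ n) :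
      finrank (ZMod p) W = n := by
    have : Finite W := Nat.finite_of_card_ne_zero (by rw [h]; positivity)
    rw [Module.natCard_eq_pow_finrank (K := ZMod p), Nat.card_zmod] at h
    exact Nat.pow_right_injective (Fact.out : p.Prime).two_le h
  obtain ⟨f⟩ := (formEquiv_extraSpecialForm hc separating (finrank_eq card_V)
    (finrank_eq (card_U.trans (pow_one p).symm))).nonempty_mulEquiv
  exact ⟨e.trans f⟩

/-- The group of type (i) splits off the coordinate `x₅`, which is central. -/
def typeIMulEquivProd (F : Type*) [Field F] : BaerGroup (typeIForm F) ≃*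
    BaerGroup (extraSpecialForm F) × Multiplicative F where
  toFun x := (⟨(x.fst.1, ![x.fst.2 0, x.fst.2 1]), x.snd⟩, .ofAdd (x.fst.2 2))
  invFun y := ⟨(y.1.fst.1, ![y.1.fst.2 0, y.1.fst.2 1, y.2.toAdd]), y.1.snd⟩
  left_inv x := by
    ext i
    · rfl
    · fin_cases i <;> rfl
    · rfl
  right_inv y := by
    ext i
    · rfl
    · fin_cases i <;> rfl
    · rfl
    · rfl
  map_mul' x y := by
    ext i
    · rfl
    · fin_cases i <;> rfl
    · rfl
    · rfl

theorem isTypeI_iff {p : ℕ} [Fact p.Prime] {G : Type*} [Group G] :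
    IsTypeI p (BaerGroup (extraSpecialForm (ZMod p))) G ↔
      Nonempty (G ≃* BaerGroup (typeIForm (ZMod p))) :=
  ⟨fun ⟨e⟩ => ⟨e.trans (typeIMulEquivProd _).symm⟩, fun ⟨e⟩ => ⟨e.trans (typeIMulEquivProd _)⟩⟩

section NotCapable

variable (F : Type*) [Field F] [NeZero (2 : F)]

theorem not_isCapable_typeIForm : ¬ IsCapable.{_, v} (BaerGroup (typeIForm F)) :=
  BaerGroup.not_isCapable_planeSum (isAlt_spaceForm F) one_ne_zero
    (y := Pi.single 0 1) (y' := Pi.single 1 1) (by simp [spaceForm])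

theorem not_isCapable_typeIIForm : ¬ IsCapable.{_, v} (BaerGroup (typeIIForm F)) :=
  BaerGroup.not_isCapable_planeSum (isAlt_spaceFormTriple F) (by simp)
    (y := Pi.single 0 1) (y' := Pi.single 1 1)
    (funext fun i => by fin_cases i <;> simp [spaceFormTriple])

theorem not_isCapable_typeIIIForm : ¬ IsCapable.{_, v} (BaerGroup (typeIIIForm F)) :=
  BaerGroup.not_isCapable_planeSum (isAlt_spaceFormPair F) (by simp)
    (y := Pi.single 0 1) (y' := Pi.single 1 1)
    (funext fun i => by fin_cases i <;> simp [spaceFormPair])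

end NotCapable

theorem BaerGroup.finrank_eq_of_mulEquiv {F V U U' G : Type*} [Field F] [Finite F]
    [AddCommGroup V] [Module F V] [AddCommGroup U] [Module F U] [AddCommGroup U'] [Module F U']
    [FiniteDimensional F V] [FiniteDimensional F U] [FiniteDimensional F U'] [Group G]
    {c : V →ₗ[F] V →ₗ[F] U} {c' : V →ₗ[F] V →ₗ[F] U'} (e : G ≃* BaerGroup c)
    (e' : G ≃* BaerGroup c') : finrank F U = finrank F U' := by
  have : Finite V := Module.finite_of_finite F
  have card_eq := Nat.card_congr (e.symm.trans e').toEquiv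
  rw [natCard_eq, natCard_eq, Nat.mul_right_inj Nat.card_pos.ne',
    natCard_eq_pow_finrank (K := F) (V := U), natCard_eq_pow_finrank (K := F) (V := U')] at card_eq
  exact Nat.pow_right_injective Finite.one_lt_card card_eq

theorem IsClassTwoExp.isType_or_isCapable {p : ℕ} [Fact p.Prime] [Fact (Odd p)] {G : Type u}
    [Group G] [Group.FG G] [IsClassTwoExp p G] (hrank : Group.rank G = 5) :
    IsTypeI p (BaerGroup (extraSpecialForm (ZMod p))) G ∨ IsTypeII p G ∨ IsTypeIII p G ∨
      IsCapable.{u, v} G := by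
  rw [isTypeI_iff, isTypeII_iff, isTypeIII_iff]
  obtain ⟨V, U, c, hc, hs, ⟨e⟩⟩ := exists_mulEquiv_baerGroup p G
  have : Group.FG (BaerGroup c) := Group.fg_of_surjective (f := e.toMonoidHom) e.surjective
  have := BaerGroup.finite_of_fg (c := c)
  have hV : finrank (ZMod p) V = 5 := by
    rw [← BaerGroup.rank_eq_finrank hc hs, ← Group.rank_congr e, hrank]
  by_cases epicenter : ∀ u, IsEpicentral c u → u = 0
  · have : Module.Finite (ZMod p) U := ⟨hs ▸ Module.Finite.fg_top.map₂ c Module.Finite.fg_top⟩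
    have : Finite V := Module.finite_of_finite (ZMod p)
    have : Finite U := Module.finite_of_finite (ZMod p)
    have b := (finBasis (ZMod p) V).reindex (finCongr hV)
    have isCapable : IsCapable.{u, v} (BaerGroup c) := BaerGroup.isCapable.{v} b hc epicenter
    exact .inr (.inr (.inr (isCapable.of_mulEquiv e)))
  · push Not at epicenter
    obtain ⟨u, hu, hu0⟩ := epicenter
    rcases hu.formEquiv hc hs hV hu0 with h | h | h <;> obtain ⟨f⟩ := h.nonempty_mulEquiv
    · exact .inl ⟨e.trans f⟩
    · exact .inr (.inl ⟨e.trans f⟩)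
    · exact .inr (.inr (.inl ⟨e.trans f⟩))

theorem mainTheorem6 (p : ℕ) (hp : p.Prime) (hodd : Odd p) :
    ∃ (E : Type) (_ : Group E),
      -- `E` is the extra-special `p`-group of order `p ^ 5` and exponent `p`
      (IsExtraSpecial p E ∧ Nat.card E = p ^ 5 ∧ Monoid.exponent E = p) ∧
      (∀ (E' : Type w) [Group E'], IsExtraSpecial p E' → Nat.card E' = p ^ 5 →
        Monoid.exponent E' = p → Nonempty (E' ≃* E)) ∧
      -- every minimally `5`-generated `G` of class at most two and exponent `p` is of exactly
      -- one of the four kinds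
      ∀ (G : Type u) [Group G] [Group.FG G], Group.rank G = 5 → IsClassLE 2 G →
        Monoid.exponent G = p →
        (IsTypeI p E G ∨ IsTypeII p G ∨ IsTypeIII p G ∨ IsCapable.{u, v} G) ∧
        ¬ (IsTypeI p E G ∧ IsTypeII p G) ∧
        ¬ (IsTypeI p E G ∧ IsTypeIII p G) ∧
        ¬ (IsTypeII p G ∧ IsTypeIII p G) ∧
        ¬ (IsTypeI p E G ∧ IsCapable.{u, v} G) ∧
        ¬ (IsTypeII p G ∧ IsCapable.{u, v} G) ∧
        ¬ (IsTypeIII p G ∧ IsCapable.{u, v} G) := by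
  have : Fact p.Prime := ⟨hp⟩
  have : Fact (Odd p) := ⟨hodd⟩
  refine ⟨BaerGroup (extraSpecialForm (ZMod p)), inferInstance,
    ⟨BaerGroup.isExtraSpecial_extraSpecialForm p,
      by rw [BaerGroup.natCard_extraSpecialForm, Nat.card_zmod],
      BaerGroup.exponent_eq (isAlt_extraSpecialForm _)⟩,
    fun E' _ hE hcard hexp => hE.nonempty_mulEquiv_extraSpecialForm hcard hexp,
    fun G _ _ hrank hclass hexp => ?_⟩
  have : IsClassTwoExp p G :=
    ⟨isClassLE_two_iff.1 hclass, fun x => hexp ▸ Monoid.pow_exponent_eq_one x⟩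
  refine ⟨IsClassTwoExp.isType_or_isCapable hrank, ?_⟩
  rw [isTypeI_iff, isTypeII_iff, isTypeIII_iff]
  refine ⟨fun ⟨⟨e⟩, ⟨e'⟩⟩ => absurd (BaerGroup.finrank_eq_of_mulEquiv e e') (by simp),
    fun ⟨⟨e⟩, ⟨e'⟩⟩ => absurd (BaerGroup.finrank_eq_of_mulEquiv e e') (by simp),
    fun ⟨⟨e⟩, ⟨e'⟩⟩ => absurd (BaerGroup.finrank_eq_of_mulEquiv e e') (by simp),
    fun ⟨⟨e⟩, h⟩ => not_isCapable_typeIForm _ (h.of_mulEquiv e.symm),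
    fun ⟨⟨e⟩, h⟩ => not_isCapable_typeIIForm _ (h.of_mulEquiv e.symm),
    fun ⟨⟨e⟩, h⟩ => not_isCapable_typeIIIForm _ (h.of_mulEquiv e.symm)⟩
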